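/- Write $e(t):=e^{2\pi i t}$, $\mathbb{T}:=\mathbb{R}/\mathbb{Z}$, $\mathbb{S}^1:=\{z\in\mathbb{C}:|z|=1\}$, $[N]:=\{1,\dots,N\}$, let $m_{\mathbb{T}^d}$ be the normalized Haar measure on $\mathbb{T}^d$, and write $f\prec g$ if $f(t)/g(t)\to 0$ as $t\to+\infty$. A Hardy field is a subfield of the ring of germs at $+\infty$ of real valued functions that is closed under differentiation and, as is assumed throughout, under the translations $a(t)\mapsto a(t+h)$, $h\in\mathbb{R}$; a Hardy field function is a function whose germ belongs to some Hardy field. A sequence $b\colon\mathbb{Z}\to\mathbb{S}^1$ admits correlations on $\mathbf{M}=([M_k])_{k\in\mathbb{N}}$, where $M_k\to\infty$, if $\lim_{k\to\infty}\frac1{M_k}\sum_{m=1}^{M_k}\prod_{j=1}^s f_j(b(m+n_j))$ exists for all $s\in\mathbb{N}$, $n_1,\dots,n_s\in\mathbb{Z}$ and $f_1,\dots,f_s\in C(\mathbb{S}^1)$; its Furstenberg system on $\mathbf{M}$ is then $((\mathbb{S}^1)^{\mathbb{Z}},\mu,T)$, where $(Tx)(n)=x(n+1)$ and $\mu$ is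 the weak-star limit of the measures $\frac1{M_k}\sum_{m=1}^{M_k}\delta_{T^m b}$. A sequence defined on the positive integers is extended to $\mathbb{Z}$ in an arbitrary way. Proposition. Let $a\colon[0,\infty)\to\mathbb{R}$ be a Hardy field function such that for some integer $d\ge 0$ either $t^d\prec a(t)\prec t^{d+1}$, or $a(t)=t^d\alpha+\tilde a(t)$ with $\alpha$ irrational and $\tilde a(t)\prec t^d$. Let $M_k\to\infty$ be a sequence of positive integers for which the weak-star limit $$\lambda:=\lim_{k\to\infty}\frac1{M_k}\sum_{n=1}^{M_k}\delta_{c(n)},\qquad c(t):=a^{(d)}(t) \bmod 1,$$ exists as a measure on $\mathbb{T}$ (finitely many $n$ for which $a^{(d)}(n)$ is not defined play no role). Then the sequence $b(n):=e(a(n))$, $n\ge 1$, admits correlations on $\mathbf{M}=([M_k])_{k\in\mathbb{N}}$, and its Furstenberg system on $\mathbf{M}$ is isomorphic, as a measure preserving system, to $(\mathbb{T}^{d+1},\lambda\times m_{\mathbb{T}^d},S_d)$, where $$S_d(y_0,\dots,y_d):=(y_0,\,y_1+y_0,\,\dots,\,y_d+y_{d-1}).$$ -/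

import Mathlib

open Filter Topology MeasureTheory Asymptotics
open scoped ENNReal Real

noncomputable section

/-- The unit circle carries its Borel `σ`-algebra. -/
instance instMeasurableSpaceUnitCircle : MeasurableSpace Circle := borel Circle

instance instBorelSpaceUnitCircle : BorelSpace Circle := ⟨rfl⟩

/-! ### Hardy fields -/

/-- A (translation invariant) Hardy field: a subfield of the ring of germs at `+∞` of real valued
functions that is closed under differentiation and under translations `a(t) ↦ a(t + h)`. -/
structure IsHardyField (H : Subring (Germ (atTop : Filter ℝ) ℝ)) : Prop where
  /-- every non-zero element has an inverse in `H` -/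
  exists_inv : ∀ x ∈ H, x ≠ 0 → ∃ y ∈ H, x * y = 1
  /-- every element is eventually differentiable -/
  differentiable : ∀ f : ℝ → ℝ, (f : Germ (atTop : Filter ℝ) ℝ) ∈ H →
    ∀ᶠ t in atTop, DifferentiableAt ℝ f t
  /-- the derivative of every element belongs to `H` -/
  deriv_mem : ∀ f : ℝ → ℝ, (f : Germ (atTop : Filter ℝ) ℝ) ∈ H →
    (deriv f : Germ (atTop : Filter ℝ) ℝ) ∈ H
  /-- translates of elements belong to `H` -/
  translate_mem : ∀ f : ℝ → ℝ, (f : Germ (atTop : Filter ℝ) ℝ) ∈ H → ∀ h : ℝ,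
    ((fun t => f (t + h) : ℝ → ℝ) : Germ (atTop : Filter ℝ) ℝ) ∈ H

/-- A Hardy field function: a function whose germ at `+∞` belongs to some Hardy field.  Only the
values of `a` for large `t` matter, so functions on `[0, ∞)` are represented by functions on `ℝ`. -/
def IsHardyFieldFunction (a : ℝ → ℝ) : Prop :=
  ∃ H : Subring (Germ (atTop : Filter ℝ) ℝ),
    IsHardyField H ∧ (a : Germ (atTop : Filter ℝ) ℝ) ∈ H

/-! ### Empirical measures and weak-star limits -/

/-- The measure `𝔼_{n ∈ [N]} δ_{x(n)}`, where `[N] = {1, …, N}`. -/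
def empiricalMeasure {X : Type*} [MeasurableSpace X] (x : ℕ → X) (N : ℕ) : Measure X :=
  (N : ℝ≥0∞)⁻¹ • ∑ n ∈ Finset.Icc 1 N, Measure.dirac (x n)

/-- `μ` is the weak-star limit of the sequence of measures `ν k`. -/
def IsWeakStarLimit {X : Type*} [TopologicalSpace X] [MeasurableSpace X]
    (ν : ℕ → Measure X) (μ : Measure X) : Prop :=
  ∀ f : C(X, ℝ), Tendsto (fun k => ∫ x, f x ∂(ν k)) atTop (𝓝 (∫ x, f x ∂μ))

/-! ### Furstenberg systems -/

/-- The sequence `b : ℤ → Y` admits correlations on the sequence of intervals `([M k])`. -/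
def AdmitsCorrelations {Y : Type*} [TopologicalSpace Y] (b : ℤ → Y) (M : ℕ → ℕ) : Prop :=
  ∀ (s : ℕ) (n : Fin s → ℤ) (f : Fin s → C(Y, ℂ)), ∃ L : ℂ,
    Tendsto (fun k => (M k : ℂ)⁻¹ * ∑ m ∈ Finset.Icc 1 (M k), ∏ j, f j (b ((m : ℤ) + n j)))
      atTop (𝓝 L)

/-- The shift `(T x)(n) = x(n + 1)` on `Y^ℤ`. -/
def shiftMap (Y : Type*) (x : ℤ → Y) : ℤ → Y := fun n => x (n + 1)

/-- `(Y^ℤ, μ, shift)` is the Furstenberg system of `b` on `([M k])`: the probability measure `μ` is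
the weak-star limit of `𝔼_{m ∈ [M k]} δ_{T^m b}`. -/
def IsFurstenbergMeasure {Y : Type*} [TopologicalSpace Y] [MeasurableSpace Y]
    (b : ℤ → Y) (M : ℕ → ℕ) (μ : Measure (ℤ → Y)) : Prop :=
  IsProbabilityMeasure μ ∧
    IsWeakStarLimit (fun k => empiricalMeasure (fun m => (shiftMap Y)^[m] b) (M k)) μ

/-! ### Measure preserving systems and their isomorphisms -/

/-- `(X, μ, T)` is a measure preserving system: `μ` is a probability measure and `T` is invertible,
bimeasurable and measure preserving. -/
structure IsSystem {X : Type*} [MeasurableSpace X] (μ : Measure X) (T : X → X) : Prop where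
  isProbabilityMeasure : IsProbabilityMeasure μ
  measurePreserving : MeasurePreserving T μ μ
  exists_inverse : ∃ R : X → X, Measurable R ∧ Function.LeftInverse R T ∧
    Function.RightInverse R T

/-- `(X, μ, T)` and `(Z, ν, S)` are isomorphic measure preserving systems: there are measure
preserving maps between them that are inverse to each other almost everywhere and that intertwine
the transformations almost everywhere. -/
def AreIsomorphicSystems {X Z : Type*} [MeasurableSpace X] [MeasurableSpace Z]
    (μ : Measure X) (T : X → X) (ν : Measure Z) (S : Z → Z) : Prop :=
  IsSystem μ T ∧ IsSystem ν S ∧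
    ∃ (φ : X → Z) (ψ : Z → X), MeasurePreserving φ μ ν ∧ MeasurePreserving ψ ν μ ∧
      (∀ᵐ x ∂μ, ψ (φ x) = x) ∧ (∀ᵐ z ∂ν, φ (ψ z) = z) ∧ (∀ᵐ x ∂μ, φ (T x) = S (φ x))

/-! ### The unipotent models on tori -/

/-- `S_d(y_0, …, y_d) = (y_0, y_1 + y_0, …, y_d + y_{d-1})` on `𝕋^{d+1}`. -/
def unipotentMap (d : ℕ) (y : Fin (d + 1) → UnitAddCircle) : Fin (d + 1) → UnitAddCircle :=
  Fin.cons (y 0) (fun i : Fin d => y i.succ + y i.castSucc)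

/-- The measure `lam × m_{𝕋^d}` on `𝕋^{d+1}`: the coordinate `y_0` has law `lam`, the other
coordinates are given the normalized Haar measure. -/
def unipotentMeasure (d : ℕ) (lam : Measure UnitAddCircle) :
    Measure (Fin (d + 1) → UnitAddCircle) :=
  Measure.pi (fun i => if i = 0 then lam else AddCircle.haarAddCircle)

end

/-! Let Δ be the forward difference and let y(t) be the torus point with coordinates Δ^d a(t), …,
Δa(t), a(t) mod 1 (`differencePoint`). From y(t) to y(t+1) the coordinates of index i ≥ 1 follow the
recursion of S_d exactly, while coordinate 0 moves by Δ^{d+1} a(t), which tends to 0 because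
a^{(d+1)} does. Hence y(n+h) is asymptotic to S_d^h y(n) for each fixed integer h, and b(n+h) is
asymptotic to the last coordinate of S_d^h y(n): the shifted sequence T^n b is asymptotically the
coding of y(n) by the last coordinates of its orbit (`orbitCoding`). This coding is continuous and
equivariant, and injective because differencing recovers the other coordinates. So once y(n) has law
λ × m along M, the Furstenberg measure is the image of that law under an embedding, which is the
isomorphism.

The law of y(n) comes from Weyl's criterion. A character depending on coordinate 0 only is governed
by λ, since Δ^d a − a^{(d)} → 0. Any other character gives 𝐞(g(n)) with g = Σ k_j Δ^{d-j} a; if i ≥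
1 is the last index with k_i ≠ 0, then g^{(i)} has the limit of k_i a^{(d)}, infinite or irrational,
and g^{(i+1)} → 0. One needs Σ_{n<N} 𝐞(g(n)) = o(N) (`IsHardyField.meanZero_fourierChar`).

Van der Corput differencing reduces this to i = 1. If g' tends to an irrational number, consecutive
terms have nearly constant ratio different from 1 and the sum telescopes. If g' → ±∞, fixed lags are
useless: for g = t log t the lagged differences behave like k log t, whose exponentials do not
average to 0. Lags growing with N are used instead, and their correlations are bounded by
Kusmin–Landau (`meanZero_fourierChar_of_secondDiff`). This needs g'' not to decay too fast, which
divergence of g' forces in a Hardy field: g''^4 t^5 is eventually increasing when g' → +∞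
(`IsHardyField.exists_monotoneOn_pow_mul`). -/

open FourierTransform

/-! ### Cesàro means. -/

/-- The Cesàro averages of `z` tend to zero. -/
def MeanZero (z : ℕ → ℂ) : Prop :=
  Tendsto (fun N : ℕ => (N : ℝ)⁻¹ • ∑ n ∈ Finset.range N, z n) atTop (𝓝 0)

theorem meanZero_iff {z : ℕ → ℂ} :
    MeanZero z ↔ ∀ ε > 0, ∀ᶠ N : ℕ in atTop, ‖∑ n ∈ Finset.range N, z n‖ ≤ ε * N := by
  unfold MeanZero
  constructor
  · intro h ε hε
    have := (Metric.tendsto_nhds.1 h ε hε)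
    filter_upwards [this, eventually_gt_atTop 0] with N hN hN0
    have hN0' : (0 : ℝ) < N := by exact_mod_cast hN0
    rw [dist_zero_right, norm_smul, norm_inv, Real.norm_of_nonneg hN0'.le] at hN
    rw [inv_mul_lt_iff₀ hN0'] at hN
    linarith
  · intro h
    rw [Metric.tendsto_nhds]
    intro ε hε
    filter_upwards [h (ε / 2) (by positivity), eventually_gt_atTop 0] with N hN hN0
    have hN0' : (0 : ℝ) < N := by exact_mod_cast hN0
    rw [dist_zero_right, norm_smul, norm_inv, Real.norm_of_nonneg hN0'.le,
      inv_mul_lt_iff₀ hN0']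
    nlinarith

theorem meanZero_of_tendsto {z : ℕ → ℂ} (h : Tendsto z atTop (𝓝 0)) : MeanZero z :=
  h.cesaro_smul

theorem MeanZero.add {z w : ℕ → ℂ} (hz : MeanZero z) (hw : MeanZero w) :
    MeanZero (fun n => z n + w n) := by
  have := Tendsto.add hz hw
  simpa [MeanZero, Finset.sum_add_distrib, smul_add] using this

theorem MeanZero.const_mul {z : ℕ → ℂ} (hz : MeanZero z) (c : ℂ) :
    MeanZero (fun n => c * z n) := by
  have := Tendsto.const_mul c hz
  simpa [MeanZero, ← Finset.mul_sum, mul_left_comm] using this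

theorem MeanZero.conj {z : ℕ → ℂ} (hz : MeanZero z) :
    MeanZero (fun n => (starRingEnd ℂ) (z n)) := by
  rw [meanZero_iff] at *
  intro ε hε
  filter_upwards [hz ε hε] with N hN
  rw [← map_sum, RCLike.norm_conj]
  exact hN

theorem norm_sum_shift_sub_le {z : ℕ → ℂ} {C : ℝ} (hz : ∀ n, ‖z n‖ ≤ C) (N h : ℕ) :
    ‖∑ n ∈ Finset.range N, z (n + h) - ∑ n ∈ Finset.range N, z n‖ ≤ 2 * C * h := by
  induction h with
  | zero => simp
  | succ h ih =>
    have key : ∑ n ∈ Finset.range N, z (n + (h + 1)) =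
        ∑ n ∈ Finset.range N, z (n + h) + (z (N + h) - z h) := by
      have h1 := Finset.sum_range_succ (fun n => z (n + h)) N
      have h2 := Finset.sum_range_succ' (fun n => z (n + h)) N
      simp only [zero_add] at h2
      have h3 : ∀ n, z (n + (h + 1)) = z (n + 1 + h) := fun n => by congr 1; ring
      simp only [h3]
      linear_combination h1 - h2
    have h4 : ‖z (N + h) - z h‖ ≤ 2 * C := by
      refine (norm_sub_le _ _).trans ?_
      linarith [hz (N + h), hz h]
    rw [key]
    calc _ = ‖(∑ n ∈ Finset.range N, z (n + h) - ∑ n ∈ Finset.range N, z n)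
          + (z (N + h) - z h)‖ := by congr 1; ring
      _ ≤ 2 * C * h + 2 * C := (norm_add_le _ _).trans (add_le_add ih h4)
      _ = _ := by push_cast; ring

theorem meanZero_shift_sub {z : ℕ → ℂ} {C : ℝ} (hz : ∀ n, ‖z n‖ ≤ C) :
    MeanZero (fun n => z (n + 1) - z n) := by
  rw [meanZero_iff]
  intro ε hε
  filter_upwards [(tendsto_natCast_atTop_atTop (R := ℝ)).eventually_ge_atTop (2 * C / ε)]
    with N hN
  rw [Finset.sum_sub_distrib]
  have := norm_sum_shift_sub_le hz N 1
  rw [div_le_iff₀ hε] at hN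
  push_cast at this
  linarith

/-! ### Van der Corput's inequality. -/

theorem card_filter_near_le (H K h : ℕ) :
    ((Finset.range H).filter (fun j => h < j + K ∧ j < h + K)).card ≤ 2 * K := by
  calc _ ≤ (Finset.Ico (h + 1 - K) (h + K)).card := by
        refine Finset.card_le_card fun j hj => ?_
        simp only [Finset.mem_filter, Finset.mem_range, Finset.mem_Ico] at *
        omega
    _ ≤ 2 * K := by rw [Nat.card_Ico]; omega

/-- Van der Corput's inequality. -/
theorem norm_sum_le_vanDerCorput {z : ℕ → ℂ} (hz : ∀ n, ‖z n‖ ≤ 1) (N H K : ℕ) (hH : 0 < H)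
    {D : ℝ} (hD0 : 0 ≤ D)
    (hD : ∀ k, K ≤ k → k < H →
      ‖∑ n ∈ Finset.range N, z (n + k) * (starRingEnd ℂ) (z n)‖ ≤ D) :
    ‖∑ n ∈ Finset.range N, z n‖ ≤ H + √(N * (2 * K * N / H + D + 2 * H)) := by
  have hH' : (0 : ℝ) < H := by exact_mod_cast hH
  set S := ∑ n ∈ Finset.range N, z n with hS
  set B := ∑ n ∈ Finset.range N, ∑ h ∈ Finset.range H, z (n + h) with hB
  have hw : ∀ k n, ‖z (n + k) * (starRingEnd ℂ) (z n)‖ ≤ 1 := fun k n => by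
    rw [norm_mul, RCLike.norm_conj]
    exact mul_le_one₀ (hz _) (norm_nonneg _) (hz _)
  -- comparison of the sum with the averaged sum
  have h1 : ‖(H : ℂ) * S‖ ≤ (H : ℝ) ^ 2 + ‖B‖ := by
    have e1 : (H : ℂ) * S = B - ∑ h ∈ Finset.range H,
        (∑ n ∈ Finset.range N, z (n + h) - S) := by
      rw [Finset.sum_sub_distrib, hB, Finset.sum_comm]
      simp
    have e2 : ‖∑ h ∈ Finset.range H, (∑ n ∈ Finset.range N, z (n + h) - S)‖ ≤ (H : ℝ) ^ 2 := by
      calc _ ≤ ∑ h ∈ Finset.range H, 2 * 1 * (h : ℝ) :=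
            norm_sum_le_of_le _ fun h _ => norm_sum_shift_sub_le hz N h
        _ ≤ (H : ℝ) ^ 2 := by
            have := Finset.sum_range_id_mul_two H
            have h2 : (∑ h ∈ Finset.range H, (h : ℝ)) * 2 = H * ((H - 1 : ℕ) : ℝ) := by
              rw [← Nat.cast_mul, ← this]; push_cast; rfl
            rw [← Finset.mul_sum]
            have h3 : ((H - 1 : ℕ) : ℝ) ≤ H := by exact_mod_cast Nat.sub_le H 1
            nlinarith
    rw [e1]
    calc _ ≤ ‖B‖ + _ := norm_sub_le _ _
      _ ≤ _ := by linarith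
  -- correlations of shifted sequences
  have hcorr : ∀ k j, j < H → k < H →
      ‖∑ n ∈ Finset.range N, z (n + (j + k)) * (starRingEnd ℂ) (z (n + j))‖ ≤
        (if k < K then (N : ℝ) else 0) + D + 2 * H := by
    intro k j hj hk
    have h2 := norm_sum_shift_sub_le (hw k) N j
    have h3 : ‖∑ n ∈ Finset.range N, z (n + k) * (starRingEnd ℂ) (z n)‖ ≤
        (if k < K then (N : ℝ) else 0) + D := by
      split_ifs with hkK
      · calc _ ≤ ∑ n ∈ Finset.range N, (1 : ℝ) := norm_sum_le_of_le _ fun n _ => hw k n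
          _ ≤ _ := by simp [hD0]
      · simpa using hD k (not_lt.1 hkK) hk
    have hj' : (j : ℝ) ≤ H := by exact_mod_cast hj.le
    have h4 : ∀ n, z (n + (j + k)) = z (n + j + k) := fun n => by rw [add_assoc]
    simp only [h4]
    have h5 := norm_sub_norm_le
      (∑ n ∈ Finset.range N, z (n + j + k) * (starRingEnd ℂ) (z (n + j)))
      (∑ n ∈ Finset.range N, z (n + k) * (starRingEnd ℂ) (z n))
    linarith
  -- Pairs with |h − j| < K get the trivial bound N; the others are correlations of lag in [K, H),
  -- translated by less than H, which costs the extra 2H.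
  have hpair : ∀ h j, h < H → j < H →
      ‖∑ n ∈ Finset.range N, z (n + h) * (starRingEnd ℂ) (z (n + j))‖ ≤
        (if h < j + K ∧ j < h + K then (N : ℝ) else 0) + D + 2 * H := by
    intro h j hh hj
    rcases le_total j h with hle | hle
    · obtain ⟨k, rfl⟩ := Nat.exists_eq_add_of_le hle
      refine (hcorr k j hj (by omega)).trans (le_of_eq ?_)
      have : (j + k < j + K ∧ j < j + k + K) ↔ k < K := by omega
      simp only [this]
    · obtain ⟨k, rfl⟩ := Nat.exists_eq_add_of_le hle
      have e : ‖∑ n ∈ Finset.range N, z (n + h) * (starRingEnd ℂ) (z (n + (h + k)))‖ =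
          ‖∑ n ∈ Finset.range N, z (n + (h + k)) * (starRingEnd ℂ) (z (n + h))‖ := by
        rw [← RCLike.norm_conj, map_sum]
        congr 1
        refine Finset.sum_congr rfl fun n _ => ?_
        simp [mul_comm]
      rw [e]
      refine (hcorr k h hh (by omega)).trans (le_of_eq ?_)
      have : (h < h + k + K ∧ h + k < h + K) ↔ k < K := by omega
      simp only [this]
  have h2 : ∑ n ∈ Finset.range N, ‖∑ h ∈ Finset.range H, z (n + h)‖ ^ 2 ≤
      2 * K * H * N + (H : ℝ) ^ 2 * (D + 2 * H) := by
    have e1 : ((∑ n ∈ Finset.range N, ‖∑ h ∈ Finset.range H, z (n + h)‖ ^ 2 : ℝ) : ℂ) =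
        ∑ h ∈ Finset.range H, ∑ j ∈ Finset.range H,
          ∑ n ∈ Finset.range N, z (n + h) * (starRingEnd ℂ) (z (n + j)) := by
      push_cast
      have : ∀ n, (‖∑ h ∈ Finset.range H, z (n + h)‖ : ℂ) ^ 2 =
          ∑ h ∈ Finset.range H, ∑ j ∈ Finset.range H,
            z (n + h) * (starRingEnd ℂ) (z (n + j)) := by
        intro n
        rw [← Complex.mul_conj', map_sum, Finset.sum_mul_sum]
      simp only [this]
      rw [Finset.sum_comm]
      refine Finset.sum_congr rfl fun h _ => ?_
      rw [Finset.sum_comm]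
    have e2 : ∑ n ∈ Finset.range N, ‖∑ h ∈ Finset.range H, z (n + h)‖ ^ 2 =
        ‖((∑ n ∈ Finset.range N, ‖∑ h ∈ Finset.range H, z (n + h)‖ ^ 2 : ℝ) : ℂ)‖ := by
      rw [Complex.norm_real, Real.norm_of_nonneg]
      positivity
    rw [e2, e1]
    calc _ ≤ ∑ h ∈ Finset.range H, ∑ j ∈ Finset.range H,
          ((if h < j + K ∧ j < h + K then (N : ℝ) else 0) + D + 2 * H) :=
          norm_sum_le_of_le _ fun h hh => norm_sum_le_of_le _ fun j hj =>
            hpair h j (Finset.mem_range.1 hh) (Finset.mem_range.1 hj)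
      _ ≤ ∑ h ∈ Finset.range H, (2 * K * N + H * (D + 2 * H) : ℝ) := by
          refine Finset.sum_le_sum fun h _ => ?_
          simp only [add_assoc]
          rw [Finset.sum_add_distrib, ← Finset.sum_filter, Finset.sum_const, Finset.sum_const,
            nsmul_eq_mul, nsmul_eq_mul, Finset.card_range]
          have := card_filter_near_le H K h
          have h3 : (((Finset.range H).filter (fun j => h < j + K ∧ j < h + K)).card : ℝ) ≤
            2 * K := by exact_mod_cast this
          have hN : (0 : ℝ) ≤ N := by positivity
          nlinarith
      _ = _ := by
          rw [Finset.sum_const, nsmul_eq_mul, Finset.card_range]; ring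
  have h3 : ‖B‖ ≤ H * √(N * (2 * K * N / H + D + 2 * H)) := by
    have e1 : ‖B‖ ≤ ∑ n ∈ Finset.range N, ‖∑ h ∈ Finset.range H, z (n + h)‖ := norm_sum_le _ _
    have e2 := sq_sum_le_card_mul_sum_sq (s := Finset.range N)
      (f := fun n => ‖∑ h ∈ Finset.range H, z (n + h)‖)
    rw [Finset.card_range] at e2
    have e3 : ‖B‖ ^ 2 ≤ (H : ℝ) ^ 2 * (N * (2 * K * N / H + D + 2 * H)) := by
      calc ‖B‖ ^ 2 ≤ _ := pow_le_pow_left₀ (norm_nonneg _) e1 2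
        _ ≤ _ := e2
        _ ≤ N * (2 * K * H * N + (H : ℝ) ^ 2 * (D + 2 * H)) :=
          mul_le_mul_of_nonneg_left h2 (by positivity)
        _ = _ := by field_simp; ring
    calc ‖B‖ ≤ √((H : ℝ) ^ 2 * (N * (2 * K * N / H + D + 2 * H))) := Real.le_sqrt_of_sq_le e3
      _ = _ := by rw [Real.sqrt_mul (by positivity), Real.sqrt_sq hH'.le]
  rw [norm_mul, Complex.norm_natCast] at h1
  have : (H : ℝ) * ‖S‖ ≤ H * (H + √(N * (2 * K * N / H + D + 2 * H))) := by nlinarith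
  exact le_of_mul_le_mul_left this hH'

/-- With `K = 1` only the diagonal is bounded trivially. For fixed `H` the finitely many other lags
are eventually negligible, leaving a bound of order N√(2/H). -/
theorem meanZero_of_correlations {z : ℕ → ℂ} (hz : ∀ n, ‖z n‖ ≤ 1)
    (h : ∀ k, 0 < k → MeanZero (fun n => z (n + k) * (starRingEnd ℂ) (z n))) : MeanZero z := by
  rw [meanZero_iff]
  intro ε hε
  obtain ⟨H, hH⟩ := exists_nat_gt (16 / ε ^ 2)
  have hH0 : (0 : ℝ) < H := lt_trans (by positivity) hH
  have hD : ∀ᶠ N : ℕ in atTop, ∀ k ∈ Finset.range H, 0 < k →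
      ‖∑ n ∈ Finset.range N, z (n + k) * (starRingEnd ℂ) (z n)‖ ≤ ε ^ 2 / 16 * N := by
    rw [eventually_all_finset]
    intro k _
    by_cases hk : 0 < k
    · filter_upwards [meanZero_iff.1 (h k hk) (ε ^ 2 / 16) (by positivity)] with N hN _
      exact hN
    · exact Eventually.of_forall fun N h0 => absurd h0 hk
  filter_upwards [hD, (tendsto_natCast_atTop_atTop (R := ℝ)).eventually_ge_atTop (2 * H / ε),
    (tendsto_natCast_atTop_atTop (R := ℝ)).eventually_ge_atTop (32 * H / ε ^ 2)] with N hN h1 h2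
  have := norm_sum_le_vanDerCorput hz N H 1 (by exact_mod_cast hH0)
    (D := ε ^ 2 / 16 * N) (by positivity)
    (fun k hk hkH => hN k (Finset.mem_range.2 hkH) hk)
  rw [div_le_iff₀ (by positivity)] at h1 h2
  have h3 : √((N : ℝ) * (2 * (1 : ℕ) * N / H + ε ^ 2 / 16 * N + 2 * H)) ≤ ε / 2 * N := by
    rw [Real.sqrt_le_iff]
    refine ⟨by positivity, ?_⟩
    have h4 : (2 * (1 : ℕ) * N / H : ℝ) ≤ ε ^ 2 / 8 * N := by
      rw [div_le_iff₀ hH0]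
      rw [div_lt_iff₀ (by positivity)] at hH
      have : (0 : ℝ) ≤ N := by positivity
      push_cast
      nlinarith
    calc (N : ℝ) * (2 * (1 : ℕ) * N / H + ε ^ 2 / 16 * N + 2 * H)
        ≤ N * (ε ^ 2 / 8 * N + ε ^ 2 / 16 * N + ε ^ 2 / 16 * N) := by
          refine mul_le_mul_of_nonneg_left ?_ (by positivity)
          linarith
      _ = _ := by ring
  linarith

/-! ### Kusmin–Landau and sums with slowly decaying second difference. -/

theorem four_mul_le_norm_fourierChar_sub_one {θ : ℝ} (h0 : 0 ≤ θ) (h1 : θ ≤ 1 / 2) :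
    4 * θ ≤ ‖(𝐞 θ : ℂ) - 1‖ := by
  rw [Real.fourierChar_apply, mul_comm (_ : ℂ) Complex.I, Complex.norm_exp_I_mul_ofReal_sub_one]
  have := Real.mul_le_sin (x := π * θ) (by positivity) (by nlinarith [Real.pi_pos])
  have h2 : 2 / π * (π * θ) = 2 * θ := by field_simp
  rw [h2] at this
  rw [show 2 * π * θ / 2 = π * θ by ring]
  rw [norm_mul, Real.norm_of_nonneg (r := Real.sin (π * θ)) (by linarith)]
  norm_num
  linarith

theorem norm_fourierChar_sub_le (s t : ℝ) : ‖(𝐞 s : ℂ) - 𝐞 t‖ ≤ 2 * π * |s - t| := by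
  have : (𝐞 s : ℂ) - 𝐞 t = 𝐞 t * ((𝐞 (s - t) : ℂ) - 1) := by
    have : (𝐞 s : ℂ) = 𝐞 t * 𝐞 (s - t) := by
      rw [← Circle.coe_mul, ← AddChar.map_add_eq_mul]; congr 2; ring
    rw [this]; ring
  rw [this, norm_mul, Circle.norm_coe, one_mul, Real.fourierChar_apply,
    mul_comm (_ : ℂ) Complex.I]
  refine (Real.norm_exp_I_mul_ofReal_sub_one_le).trans ?_
  rw [Real.norm_eq_abs, abs_mul, abs_of_pos Real.two_pi_pos]

/-- A weak form of the Kusmin–Landau inequality. -/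
theorem norm_sum_fourierChar_le {x : ℕ → ℝ} {N : ℕ} {δ : ℝ} (hδ : 0 < δ)
    (hlow : ∀ n ≤ N, δ ≤ x (n + 1) - x n) (hup : ∀ n ≤ N, x (n + 1) - x n ≤ 1 / 2)
    (hanti : ∀ n < N, x (n + 2) - x (n + 1) ≤ x (n + 1) - x n) :
    ‖∑ n ∈ Finset.range N, (𝐞 (x n) : ℂ)‖ ≤ 1 / δ := by
  set θ : ℕ → ℝ := fun n => x (n + 1) - x n with hθ
  -- Each term is the increment of 𝐞(x n) times G n. Summation by parts then costs only two boundary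
  -- terms and the variation of G, whose bound telescopes because θ is decreasing.
  set G : ℕ → ℂ := fun n => ((𝐞 (θ n) : ℂ) - 1)⁻¹ with hG
  have hθpos : ∀ n ≤ N, 0 < θ n := fun n hn => hδ.trans_le (hlow n hn)
  have hden : ∀ n ≤ N, 4 * θ n ≤ ‖(𝐞 (θ n) : ℂ) - 1‖ := fun n hn =>
    four_mul_le_norm_fourierChar_sub_one (hθpos n hn).le (hup n hn)
  have hne : ∀ n ≤ N, (𝐞 (θ n) : ℂ) - 1 ≠ 0 := fun n hn h0 => by
    have := hden n hn
    rw [h0, norm_zero] at this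
    linarith [hθpos n hn]
  have hGn : ∀ n ≤ N, ‖G n‖ ≤ 1 / (4 * δ) := fun n hn => by
    rw [hG, norm_inv, ← one_div]
    exact one_div_le_one_div_of_le (by positivity) (by linarith [hden n hn, hlow n hn])
  have hstep : ∀ n ≤ N, (𝐞 (x n) : ℂ) = (𝐞 (x (n + 1)) - 𝐞 (x n)) * G n := fun n hn => by
    have e : (𝐞 (x (n + 1)) : ℂ) = 𝐞 (x n) * 𝐞 (θ n) := by
      rw [← Circle.coe_mul, ← AddChar.map_add_eq_mul]; congr 2; simp [hθ]
    rw [e, hG]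
    have := hne n hn
    field_simp
  have hGdiff : ∀ n < N, ‖G n - G (n + 1)‖ ≤ π / 8 * (1 / θ (n + 1) - 1 / θ n) := fun n hn => by
    have h1 := hθpos n hn.le
    have h2 := hθpos (n + 1) hn
    have h3 := hanti n hn
    have h3' : θ (n + 1) ≤ θ n := h3
    rw [hG]
    simp only
    rw [inv_sub_inv (hne n hn.le) (hne (n + 1) hn), norm_div, norm_mul]
    calc _ ≤ (2 * π * (θ n - θ (n + 1))) / (4 * θ n * (4 * θ (n + 1))) := by
          refine div_le_div₀ ?_ ?_ (by positivity)
            (mul_le_mul (hden n hn.le) (hden (n + 1) hn) (by positivity) (norm_nonneg _))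
          · have := sub_nonneg.2 h3'; positivity
          · have := norm_fourierChar_sub_le (θ (n + 1)) (θ n)
            rw [abs_of_nonpos (sub_nonpos.2 h3')] at this
            rw [sub_sub_sub_cancel_right]
            linarith
      _ = _ := by field_simp; ring
  have main : ∀ m ≤ N, ‖∑ n ∈ Finset.range m, (𝐞 (x n) : ℂ) - 𝐞 (x m) * G m + 𝐞 (x 0) * G 0‖ ≤
      π / 8 * (1 / θ m - 1 / θ 0) := by
    intro m
    induction m with
    | zero => intro _; simp
    | succ m ih =>
      intro hm
      have e : ∑ n ∈ Finset.range (m + 1), (𝐞 (x n) : ℂ) - 𝐞 (x (m + 1)) * G (m + 1)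
          + 𝐞 (x 0) * G 0 =
          (∑ n ∈ Finset.range m, (𝐞 (x n) : ℂ) - 𝐞 (x m) * G m + 𝐞 (x 0) * G 0)
          + 𝐞 (x (m + 1)) * (G m - G (m + 1)) := by
        rw [Finset.sum_range_succ]
        linear_combination hstep m (by omega)
      rw [e]
      refine (norm_add_le _ _).trans ?_
      rw [norm_mul, Circle.norm_coe, one_mul]
      linarith [ih (by omega), hGdiff m hm]
  have h1 := main N le_rfl
  have h2 : ‖∑ n ∈ Finset.range N, (𝐞 (x n) : ℂ)‖ ≤
      π / 8 * (1 / θ N - 1 / θ 0) + ‖G N‖ + ‖G 0‖ := by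
    have e : ∑ n ∈ Finset.range N, (𝐞 (x n) : ℂ) =
        (∑ n ∈ Finset.range N, (𝐞 (x n) : ℂ) - 𝐞 (x N) * G N + 𝐞 (x 0) * G 0)
        + 𝐞 (x N) * G N - 𝐞 (x 0) * G 0 := by ring
    rw [e]
    refine (norm_sub_le _ _).trans (add_le_add ((norm_add_le _ _).trans (add_le_add h1 ?_)) ?_)
    · rw [norm_mul, Circle.norm_coe, one_mul]
    · rw [norm_mul, Circle.norm_coe, one_mul]
  have h3 := hGn N le_rfl
  have h4 := hGn 0 (Nat.zero_le _)
  have h5 : 1 / θ N ≤ 1 / δ := one_div_le_one_div_of_le hδ (hlow N le_rfl)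
  have h6 : 0 < 1 / θ 0 := one_div_pos.2 (hθpos 0 (Nat.zero_le _))
  -- As π < 4, the variation costs at most half of 1/δ; the two boundary terms, 1/(4δ) each, make up
  -- the other half.
  have h7 : π / 8 * (1 / θ N - 1 / θ 0) ≤ 1 / 2 * (1 / δ) := by
    have : (0 : ℝ) < 1 / δ := by positivity
    nlinarith [Real.pi_lt_four, Real.pi_pos]
  have h8 : 1 / (4 * δ) = 1 / 4 * (1 / δ) := by field_simp
  rw [h8] at h3 h4
  linarith

/-- Turns bounds on the second difference into bounds on the increments of a lag-k difference, as
Kusmin–Landau requires. -/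
theorem sub_eq_sum_range_secondDiff (x : ℕ → ℝ) (m k : ℕ) :
    (x (m + k + 1) - x (m + k)) - (x (m + 1) - x m) =
      ∑ j ∈ Finset.range k, (x (m + j + 2) - 2 * x (m + j + 1) + x (m + j)) := by
  induction k with
  | zero => simp
  | succ k ih =>
    rw [Finset.sum_range_succ, ← ih]
    simp only [← add_assoc]
    rw [show m + k + 1 + 1 = m + k + 2 by ring]
    ring

/-- Van der Corput's differencing combined with the Kusmin–Landau inequality, for a sequence whose
second difference is positive and decreasing. -/
theorem norm_sum_fourierChar_le_of_secondDiff {x : ℕ → ℝ} {N q K : ℕ} {W w : ℝ}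
    (hq : 0 < q) (hK : 0 < K) (hqK : q * K ≤ N) (hw : 0 < w)
    (hlow : ∀ n ≤ 2 * N, w ≤ x (n + 2) - 2 * x (n + 1) + x n)
    (hup : ∀ n ≤ 2 * N, x (n + 2) - 2 * x (n + 1) + x n ≤ W)
    (hanti : ∀ n ≤ 2 * N, x (n + 3) - 2 * x (n + 2) + x (n + 1) ≤ x (n + 2) - 2 * x (n + 1) + x n)
    (hW : q * K * W ≤ 1 / 2) (L : ℕ) (hL : L ≤ N) :
    ‖∑ n ∈ Finset.range L, (𝐞 (x n) : ℂ)‖ ≤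
      q * K + √(N * (2 * N / q + 1 / (K * w) + 2 * (q * K))) := by
  have hW0 : 0 < W := hw.trans_le ((hlow 0 (by omega)).trans (hup 0 (by omega)))
  have hK' : (0 : ℝ) < K := by exact_mod_cast hK
  have hq' : (0 : ℝ) < q := by exact_mod_cast hq
  -- Lags below K are sacrificed: among H = qK lags they cost 2N/q. A lag k ≥ K has increments
  -- between Kw and qKW ≤ 1/2, so Kusmin–Landau bounds its correlation by 1/(Kw).
  have key := norm_sum_le_vanDerCorput (z := fun n => (𝐞 (x n) : ℂ))
    (fun n => (Circle.norm_coe _).le) L (q * K) K (Nat.mul_pos hq hK) (D := 1 / (K * w))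
    (by positivity) ?_
  · refine key.trans ?_
    push_cast
    rw [show (2 * (K : ℝ) * L / (q * K)) = 2 * L / q by field_simp]
    gcongr
  · intro k hKk hkH
    have hkN : k < N := by omega
    have hKk' : (K : ℝ) ≤ k := by exact_mod_cast hKk
    have hkH' : (k : ℝ) ≤ q * K := by exact_mod_cast hkH.le
    have e : ∀ n, (𝐞 (x (n + k)) : ℂ) * (starRingEnd ℂ) (𝐞 (x n) : ℂ) =
        𝐞 (x (n + k) - x n) := fun n => by
      rw [← Circle.coe_inv_eq_conj, ← Circle.coe_mul, ← AddChar.map_neg_eq_inv,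
        ← AddChar.map_add_eq_mul, sub_eq_add_neg]
    simp only [e]
    have hθ : ∀ n, (x (n + 1 + k) - x (n + 1)) - (x (n + k) - x n) =
        ∑ j ∈ Finset.range k, (x (n + j + 2) - 2 * x (n + j + 1) + x (n + j)) := fun n => by
      rw [← sub_eq_sum_range_secondDiff, show n + 1 + k = n + k + 1 by ring]
      ring
    refine norm_sum_fourierChar_le (x := fun n => x (n + k) - x n) (by positivity)
      (fun n hn => ?_) (fun n hn => ?_) (fun n hn => ?_)
    · rw [hθ]
      calc (K : ℝ) * w ≤ k * w := by gcongr
        _ = ∑ j ∈ Finset.range k, w := by simp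
        _ ≤ _ := Finset.sum_le_sum fun j hj => hlow _ (by
          have := Finset.mem_range.1 hj; omega)
    · rw [hθ]
      calc _ ≤ ∑ j ∈ Finset.range k, W := Finset.sum_le_sum fun j hj => hup _ (by
            have := Finset.mem_range.1 hj; omega)
        _ = k * W := by simp
        _ ≤ q * K * W := by gcongr
        _ ≤ _ := hW
    · have := hθ (n + 1)
      rw [show n + 2 = n + 1 + 1 by ring, this, hθ]
      refine Finset.sum_le_sum fun j hj => ?_
      have := hanti (n + j) (by have := Finset.mem_range.1 hj; omega)
      rw [show n + 1 + j = n + j + 1 by ring]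
      exact this

set_option maxHeartbeats 1000000 in
/-- The sums `∑ 𝐞 (x n)` are `o(N)` if the second difference of `x` decreases to zero, but slowly
and regularly. -/
theorem meanZero_fourierChar_of_secondDiff {x w : ℕ → ℝ} {n₀ : ℕ}
    (hwpos : ∀ n, n₀ ≤ n → 0 < w n) (hwanti : ∀ m n, n₀ ≤ m → m ≤ n → w n ≤ w m)
    (hw0 : Tendsto w atTop (𝓝 0))
    (hreg : ∀ m n, n₀ ≤ m → m ≤ n → w m ^ 4 * (m : ℝ) ^ 5 ≤ w n ^ 4 * (n : ℝ) ^ 5)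
    (hlow : ∀ n, n₀ ≤ n → w (n + 2) ≤ x (n + 2) - 2 * x (n + 1) + x n)
    (hup : ∀ n, n₀ ≤ n → x (n + 2) - 2 * x (n + 1) + x n ≤ w n)
    (hanti : ∀ n, n₀ ≤ n →
      x (n + 3) - 2 * x (n + 2) + x (n + 1) ≤ x (n + 2) - 2 * x (n + 1) + x n) :
    MeanZero (fun n => (𝐞 (x n) : ℂ)) := by
  rw [meanZero_iff]
  intro ε' hε'
  -- One ε pays for the discarded initial block, one for qK, two for the square root.
  obtain ⟨ε, rfl⟩ : ∃ ε, ε' = 4 * ε := ⟨ε' / 4, by ring⟩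
  have hε : 0 < ε := by linarith
  -- The block n < N/s is discarded, at cost at most εN; beyond it w varies by a bounded factor. The
  -- choice of q makes 2N/q ≤ ε²N.
  obtain ⟨s, hs⟩ := exists_nat_gt (1 / ε)
  have hs0 : (0 : ℝ) < s := lt_trans (by positivity) hs
  obtain ⟨q, hq⟩ := exists_nat_gt (2 / ε ^ 2)
  have hq0 : (0 : ℝ) < q := lt_trans (by positivity) hq
  have hsN : 0 < s := by exact_mod_cast hs0
  have hqN : 0 < q := by exact_mod_cast hq0
  have hA : Tendsto (fun N : ℕ => N / s) atTop atTop := Nat.tendsto_div_const_atTop hsN.ne'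
  obtain ⟨c, hc⟩ : ∃ c, c = w (n₀ + 1) ^ 4 * ((n₀ + 1 : ℕ) : ℝ) ^ 5 := ⟨_, rfl⟩
  have hc0 : 0 < c := hc ▸ mul_pos (pow_pos (hwpos _ (by omega)) 4) (by positivity)
  obtain ⟨R, hR⟩ : ∃ R, R = 2 / ε ^ 2 := ⟨_, rfl⟩
  have hR0 : 0 < R := by rw [hR]; positivity
  have hcast := tendsto_natCast_atTop_atTop (R := ℝ)
  have hsqrt : Tendsto (fun N : ℕ => √(N : ℝ)) atTop atTop := Real.tendsto_sqrt_atTop.comp hcast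
  filter_upwards [hA.eventually_ge_atTop (n₀ + 1), eventually_ge_atTop 2,
    (hw0.comp hA).eventually_lt_const (show (0 : ℝ) < 1 / (2 * q) by positivity),
    hcast.eventually_ge_atTop (R ^ 4 * 1024 / c),
    hcast.eventually_ge_atTop (R * (2 * q) * (8 * s) ^ 2),
    hsqrt.eventually_ge_atTop (q / ε), hsqrt.eventually_ge_atTop (2 * q / ε ^ 2),
    hsqrt.eventually_ge_atTop q]
    with N hAn₀ hN2 hwA hN3 hN4 hN5 hN6 hN7
  obtain ⟨A, hAdef⟩ : ∃ A, A = N / s := ⟨_, rfl⟩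
  rw [← hAdef] at hAn₀
  rw [Function.comp_apply, ← hAdef] at hwA
  have hN0 : (0 : ℝ) < N := by positivity
  have hsq : √(N : ℝ) * √(N : ℝ) = N := Real.mul_self_sqrt hN0.le
  have hsq1 : 1 ≤ √(N : ℝ) := by
    rw [Real.one_le_sqrt]; exact_mod_cast (by omega : 1 ≤ N)
  have hAN : A ≤ N := hAdef ▸ Nat.div_le_self _ _
  have hwA0 : 0 < w A := hwpos _ (by omega)
  have hw3 : 0 < w (4 * N) := hwpos _ (by omega)
  -- The first bound on K keeps the increments at most 1/2, the second makes qK = o(N). In either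
  -- case K·w(4N)·N is large: for the first because w(4N) is comparable to w(A), for the second
  -- because w(4N)·N^{3/2} → ∞.
  obtain ⟨m, hm⟩ : ∃ m, m = min (1 / (2 * q * w A)) (√N) := ⟨_, rfl⟩
  obtain ⟨K, hK⟩ : ∃ K, K = ⌊m⌋₊ := ⟨_, rfl⟩
  have hm1 : 1 ≤ m := by
    rw [hm]
    refine le_min ?_ hsq1
    rw [lt_div_iff₀ (by positivity)] at hwA
    rw [le_div_iff₀ (by positivity)]
    linarith
  have hKm : (K : ℝ) ≤ m := hK ▸ Nat.floor_le (by linarith)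
  have hmK : m ≤ 2 * K := by
    have h1 := Nat.lt_floor_add_one m
    have h2 : 1 ≤ K := hK ▸ Nat.one_le_floor_iff m |>.2 hm1
    have h3 : (1 : ℝ) ≤ K := by exact_mod_cast h2
    rw [← hK] at h1
    linarith
  have hK0 : (0 : ℝ) < K := by linarith
  have hKpos : 0 < K := by exact_mod_cast hK0
  have hKsq : (K : ℝ) ≤ √N := hKm.trans (hm ▸ min_le_right _ _)
  have hqKN' : (q * K : ℝ) ≤ N := by rw [← hsq]; gcongr
  have hqKN : q * K ≤ N := by exact_mod_cast hqKN'
  -- the regularity of `w` between `N / s` and `4 * N`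
  have hreg1 : w A / (8 * s) ^ 2 ≤ w (4 * N) := by
    have h1 := hreg A (4 * N) (by omega) (by omega)
    have h2 : (N : ℝ) ≤ 2 * s * A := by
      have h3 : N < s * (A + 1) := by
        rw [mul_comm, hAdef]; exact Nat.lt_mul_of_div_lt (Nat.lt_succ_self _) hsN
      have h4 : (N : ℝ) < s * (A + 1) := by exact_mod_cast h3
      have h5 : (1 : ℝ) ≤ A := by exact_mod_cast (by omega : 1 ≤ A)
      nlinarith
    have hA0 : (0 : ℝ) < A := by exact_mod_cast (by omega : 0 < A)
    have hs1 : (1 : ℝ) ≤ 8 * s := by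
      have : (1 : ℝ) ≤ s := by exact_mod_cast hsN
      linarith
    -- The exponent 5 is raised to 8 so that a fourth root can be taken.
    have h6 : w A ^ 4 ≤ (w (4 * N) * (8 * s) ^ 2) ^ 4 := by
      have h7 : w A ^ 4 * (A : ℝ) ^ 5 ≤ (w (4 * N) ^ 4 * (8 * s) ^ 5) * (A : ℝ) ^ 5 := by
        calc _ ≤ _ := h1
          _ ≤ w (4 * N) ^ 4 * (8 * s * A) ^ 5 := by
            have : ((4 * N : ℕ) : ℝ) ≤ 8 * s * A := by push_cast; linarith
            gcongr
          _ = _ := by ring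
      have h8 := le_of_mul_le_mul_right h7 (by positivity)
      calc _ ≤ _ := h8
        _ ≤ w (4 * N) ^ 4 * (8 * s) ^ 8 := by
          have := pow_le_pow_right₀ hs1 (by norm_num : 5 ≤ 8)
          gcongr
        _ = _ := by ring
    rw [div_le_iff₀ (by positivity)]
    exact (pow_le_pow_iff_left₀ hwA0.le (by positivity) (by norm_num)).1 h6
  -- Since w(n)n^{5/4} is bounded below, w(4N)N^{3/2} is at least a constant times N^{1/4}; the
  -- computation is done in fourth powers. Any exponent below 3/2 in place of 5/4 would serve here.
  have hreg2 : R ≤ w (4 * N) * (√N * N) := by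
    have h1 := hreg (n₀ + 1) (4 * N) (by omega) (by omega)
    rw [← hc] at h1
    push_cast at h1
    refine (pow_le_pow_iff_left₀ hR0.le (by positivity) (by norm_num : (4 : ℕ) ≠ 0)).1 ?_
    have h2 : (w (4 * N) * (√N * N)) ^ 4 = w (4 * N) ^ 4 * (4 * N) ^ 5 * N / 1024 := by
      calc _ = w (4 * N) ^ 4 * (√N * √N) ^ 2 * (N : ℝ) ^ 4 := by ring
        _ = _ := by rw [hsq]; ring
    rw [h2]
    rw [div_le_iff₀ hc0] at hN3
    rw [le_div_iff₀ (by norm_num)]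
    calc _ ≤ _ := hN3
      _ = c * N := mul_comm _ _
      _ ≤ _ := by gcongr
  have hKw : R ≤ 2 * (K * w (4 * N) * N) := by
    have h1 : R ≤ m * (w (4 * N) * N) := by
      rw [hm, min_mul_of_nonneg _ _ (by positivity)]
      refine le_min ?_ ?_
      · calc R ≤ N / (2 * q * (8 * s) ^ 2) := by
              rw [le_div_iff₀ (by positivity)]; linarith
          _ = 1 / (2 * q * w A) * (w A / (8 * s) ^ 2 * N) := by field_simp
          _ ≤ _ := by gcongr
      · calc R ≤ _ := hreg2
          _ = _ := by ring
    calc R ≤ _ := h1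
      _ ≤ 2 * K * (w (4 * N) * N) := by gcongr
      _ = _ := by ring
  have hL : (N - A : ℕ) ≤ N := Nat.sub_le _ _
  -- Indices reach A + 2N + 2 ≤ 3N + 2 ≤ 4N, which is why w is compared at A and 4N and why N ≥ 2.
  have main := norm_sum_fourierChar_le_of_secondDiff (x := fun n => x (A + n)) (N := N) (q := q)
    (K := K) (W := w A) (w := w (4 * N)) hqN hKpos hqKN hw3
    (fun n hn => (hwanti (A + n + 2) (4 * N) (by omega) (by omega)).trans (hlow (A + n) (by omega)))
    (fun n hn => (hup (A + n) (by omega)).trans (hwanti A (A + n) (by omega) (by omega)))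
    (fun n hn => hanti (A + n) (by omega))
    (by
      have : (K : ℝ) ≤ 1 / (2 * q * w A) := hKm.trans (hm ▸ min_le_left _ _)
      rw [le_div_iff₀ (by positivity)] at this
      linarith) (N - A) hL
  have hsplit : ∑ n ∈ Finset.range N, (𝐞 (x n) : ℂ) = ∑ n ∈ Finset.range A, (𝐞 (x n) : ℂ) +
      ∑ n ∈ Finset.range (N - A), (𝐞 (x (A + n)) : ℂ) := by
    rw [← Finset.sum_range_add (fun n => (𝐞 (x n) : ℂ)), Nat.add_sub_cancel' hAN]
  have hfirst : ‖∑ n ∈ Finset.range A, (𝐞 (x n) : ℂ)‖ ≤ ε * N := by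
    calc _ ≤ ∑ n ∈ Finset.range A, (1 : ℝ) :=
          norm_sum_le_of_le _ fun n _ => (Circle.norm_coe _).le
      _ = A := by simp
      _ ≤ N / s := hAdef ▸ Nat.cast_div_le
      _ ≤ ε * N := by
        rw [div_le_iff₀ hs0]
        rw [div_lt_iff₀ hε] at hs
        calc (N : ℝ) = 1 * N := (one_mul _).symm
          _ ≤ s * ε * N := by gcongr
          _ = _ := by ring
  have hqK1 : (q * K : ℝ) ≤ ε * N := by
    rw [div_le_iff₀ hε] at hN5
    calc (q * K : ℝ) ≤ (√N * ε) * √N := by gcongr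
      _ = ε * (√N * √N) := by ring
      _ = _ := by rw [hsq]
  have hqK2 : 2 * (q * K : ℝ) ≤ ε ^ 2 * N := by
    rw [div_le_iff₀ (by positivity)] at hN6
    calc 2 * (q * K : ℝ) = 2 * q * K := by ring
      _ ≤ (√N * ε ^ 2) * √N := by gcongr
      _ = ε ^ 2 * (√N * √N) := by ring
      _ = _ := by rw [hsq]
  have hroot : √(N * (2 * N / q + 1 / (K * w (4 * N)) + 2 * (q * K))) ≤ 2 * ε * N := by
    rw [Real.sqrt_le_iff]
    refine ⟨by positivity, ?_⟩
    have h1 : 2 * N / (q : ℝ) ≤ ε ^ 2 * N := by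
      rw [div_le_iff₀ hq0]
      rw [div_lt_iff₀ (by positivity)] at hq
      calc 2 * (N : ℝ) ≤ q * ε ^ 2 * N := by gcongr
        _ = _ := by ring
    have h2 : 1 / (K * w (4 * N)) ≤ ε ^ 2 * N := by
      rw [div_le_iff₀ (by positivity)]
      rw [hR, div_le_iff₀ (by positivity)] at hKw
      linarith
    calc _ ≤ (N : ℝ) * (ε ^ 2 * N + ε ^ 2 * N + ε ^ 2 * N) := by gcongr
      _ = 3 * (ε * N) ^ 2 := by ring
      _ ≤ 4 * (ε * N) ^ 2 := by gcongr; norm_num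
      _ = _ := by ring
  rw [hsplit]
  refine (norm_add_le _ _).trans ?_
  linarith

/-! ### Monotonicity, limits and growth in Hardy fields. -/

theorem exists_monotoneOn_Ici {f : ℝ → ℝ} (hd : ∀ᶠ t in atTop, DifferentiableAt ℝ f t)
    (h : ∀ᶠ t in atTop, 0 ≤ deriv f t) : ∃ T, MonotoneOn f (Set.Ici T) := by
  obtain ⟨T, hT⟩ := eventually_atTop.1 (hd.and h)
  refine ⟨T, monotoneOn_of_deriv_nonneg (convex_Ici T)
    (fun t ht => (hT t ht).1.continuousAt.continuousWithinAt)
    (fun t ht => (hT t (interior_subset ht)).1.differentiableWithinAt)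
    (fun t ht => (hT t (interior_subset ht)).2)⟩

theorem exists_antitoneOn_Ici {f : ℝ → ℝ} (hd : ∀ᶠ t in atTop, DifferentiableAt ℝ f t)
    (h : ∀ᶠ t in atTop, deriv f t ≤ 0) : ∃ T, AntitoneOn f (Set.Ici T) := by
  obtain ⟨T, hT⟩ := eventually_atTop.1 (hd.and h)
  refine ⟨T, antitoneOn_of_deriv_nonpos (convex_Ici T)
    (fun t ht => (hT t ht).1.continuousAt.continuousWithinAt)
    (fun t ht => (hT t (interior_subset ht)).1.differentiableWithinAt)
    (fun t ht => (hT t (interior_subset ht)).2)⟩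

theorem MonotoneOn.tendsto_atTop_or_exists {f : ℝ → ℝ} {T : ℝ} (hf : MonotoneOn f (Set.Ici T)) :
    Tendsto f atTop atTop ∨ ∃ l, Tendsto f atTop (𝓝 l) := by
  have hg : Monotone (fun t => f (max t T)) := fun s t hst =>
    hf (Set.mem_Ici.2 (le_max_right _ _)) (Set.mem_Ici.2 (le_max_right _ _))
      (max_le_max_right T hst)
  have heq : (fun t => f (max t T)) =ᶠ[atTop] f := by
    filter_upwards [eventually_ge_atTop T] with t ht
    rw [max_eq_left ht]
  rcases tendsto_atTop_of_monotone hg with h | ⟨l, h⟩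
  · exact Or.inl (h.congr' heq)
  · exact Or.inr ⟨l, h.congr' heq⟩

theorem MonotoneOn.le_of_tendsto_atTop {f : ℝ → ℝ} {T l : ℝ} (hf : MonotoneOn f (Set.Ici T))
    (h : Tendsto f atTop (𝓝 l)) {t : ℝ} (ht : T ≤ t) : f t ≤ l :=
  ge_of_tendsto h (by
    filter_upwards [eventually_ge_atTop t] with s hs
    exact hf ht (le_trans ht hs) hs)

namespace IsHardyField

variable {H : Subring (Germ (atTop : Filter ℝ) ℝ)} {f g : ℝ → ℝ}

/-- An inverse germ prevents a nonzero element from vanishing far out; continuity then fixes its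
sign. -/
theorem eventually_trichotomy (hH : IsHardyField H) (hf : (f : Germ (atTop : Filter ℝ) ℝ) ∈ H) :
    (∀ᶠ t in atTop, f t = 0) ∨ (∀ᶠ t in atTop, 0 < f t) ∨ (∀ᶠ t in atTop, f t < 0) := by
  by_cases h0 : (f : Germ (atTop : Filter ℝ) ℝ) = 0
  · left
    exact Germ.coe_eq.1 h0
  right
  obtain ⟨y, -, hy⟩ := hH.exists_inv _ hf h0
  induction y using Germ.inductionOn with | _ Y =>
  have hY : ∀ᶠ t in atTop, f t * Y t = 1 := Germ.coe_eq.1 hy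
  obtain ⟨T, hT⟩ := eventually_atTop.1 (hY.and (hH.differentiable f hf))
  have hne : ∀ t ≥ T, f t ≠ 0 := fun t ht h => by
    have := (hT t ht).1
    rw [h, zero_mul] at this
    exact zero_ne_one this
  have hcont : ContinuousOn f (Set.Ici T) := fun t ht =>
    (hT t ht).2.continuousAt.continuousWithinAt
  rcases lt_or_gt_of_ne (hne T le_rfl) with hneg | hpos
  · right
    filter_upwards [eventually_ge_atTop T] with t ht
    by_contra hcon
    obtain ⟨s, hs, hs0⟩ := isPreconnected_Ici.intermediate_value (Set.mem_Ici.2 le_rfl)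
      (Set.mem_Ici.2 ht) hcont (Set.mem_Icc.2 ⟨hneg.le, not_lt.1 hcon⟩)
    exact hne s hs hs0
  · left
    filter_upwards [eventually_ge_atTop T] with t ht
    by_contra hcon
    obtain ⟨s, hs, hs0⟩ := isPreconnected_Ici.intermediate_value (Set.mem_Ici.2 ht)
      (Set.mem_Ici.2 le_rfl) hcont (Set.mem_Icc.2 ⟨not_lt.1 hcon, hpos.le⟩)
    exact hne s hs hs0

theorem eventually_le_or_lt (hH : IsHardyField H) (hf : (f : Germ (atTop : Filter ℝ) ℝ) ∈ H) :
    (∀ᶠ t in atTop, 0 ≤ f t) ∨ (∀ᶠ t in atTop, f t < 0) := by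
  rcases hH.eventually_trichotomy hf with h | h | h
  · exact Or.inl (h.mono fun t ht => ht.ge)
  · exact Or.inl (h.mono fun t ht => ht.le)
  · exact Or.inr h

theorem iteratedDeriv_mem (hH : IsHardyField H) (hf : (f : Germ (atTop : Filter ℝ) ℝ) ∈ H)
    (n : ℕ) : (iteratedDeriv n f : Germ (atTop : Filter ℝ) ℝ) ∈ H := by
  induction n with
  | zero => simpa using hf
  | succ n ih => rw [iteratedDeriv_succ]; exact hH.deriv_mem _ ih

theorem neg_mem (hf : (f : Germ (atTop : Filter ℝ) ℝ) ∈ H) :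
    ((fun t => -f t : ℝ → ℝ) : Germ (atTop : Filter ℝ) ℝ) ∈ H :=
  H.neg_mem hf

theorem sub_mem (hf : (f : Germ (atTop : Filter ℝ) ℝ) ∈ H)
    (hg : (g : Germ (atTop : Filter ℝ) ℝ) ∈ H) :
    ((fun t => f t - g t : ℝ → ℝ) : Germ (atTop : Filter ℝ) ℝ) ∈ H :=
  H.sub_mem hf hg

theorem mul_mem (hf : (f : Germ (atTop : Filter ℝ) ℝ) ∈ H)
    (hg : (g : Germ (atTop : Filter ℝ) ℝ) ∈ H) :
    ((fun t => f t * g t : ℝ → ℝ) : Germ (atTop : Filter ℝ) ℝ) ∈ H :=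
  H.mul_mem hf hg

theorem intCast_mem (k : ℤ) :
    ((fun _ => (k : ℝ) : ℝ → ℝ) : Germ (atTop : Filter ℝ) ℝ) ∈ H :=
  _root_.intCast_mem H k

theorem intCast_mul_mem (k : ℤ) (hf : (f : Germ (atTop : Filter ℝ) ℝ) ∈ H) :
    ((fun t => k * f t : ℝ → ℝ) : Germ (atTop : Filter ℝ) ℝ) ∈ H :=
  mul_mem (intCast_mem k) hf

theorem sum_mem {ι : Type*} (s : Finset ι) {F : ι → ℝ → ℝ}
    (hF : ∀ i ∈ s, (F i : Germ (atTop : Filter ℝ) ℝ) ∈ H) :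
    ((fun t => ∑ i ∈ s, F i t : ℝ → ℝ) : Germ (atTop : Filter ℝ) ℝ) ∈ H := by
  classical
  induction s using Finset.induction_on with
  | empty => simpa using intCast_mem (H := H) 0
  | insert i s hi ih =>
    simp only [Finset.sum_insert hi]
    exact H.add_mem (hF i (Finset.mem_insert_self _ _))
      (ih fun j hj => hF j (Finset.mem_insert_of_mem hj))

theorem fwdDiff_mem (hH : IsHardyField H) (hf : (f : Germ (atTop : Filter ℝ) ℝ) ∈ H) (h : ℝ) :
    (fwdDiff h f : Germ (atTop : Filter ℝ) ℝ) ∈ H :=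
  sub_mem (hH.translate_mem f hf h) hf

theorem eventually_contDiffAt (hH : IsHardyField H) (hf : (f : Germ (atTop : Filter ℝ) ℝ) ∈ H)
    (n : ℕ) : ∀ᶠ t in atTop, ContDiffAt ℝ n f t := by
  suffices h : ∃ T, ContDiffOn ℝ n f (Set.Ioi T) by
    obtain ⟨T, hT⟩ := h
    filter_upwards [eventually_gt_atTop T] with t ht
    exact hT.contDiffAt (isOpen_Ioi.mem_nhds ht)
  induction n generalizing f with
  | zero =>
    obtain ⟨T, hT⟩ := eventually_atTop.1 (hH.differentiable f hf)
    refine ⟨T, ?_⟩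
    rw [Nat.cast_zero, contDiffOn_zero]
    exact fun t ht => (hT t (le_of_lt ht)).continuousAt.continuousWithinAt
  | succ n ih =>
    obtain ⟨T, hT⟩ := eventually_atTop.1 (hH.differentiable f hf)
    obtain ⟨T', hT'⟩ := ih (hH.deriv_mem f hf)
    refine ⟨max T T', ?_⟩
    rw [Nat.cast_succ, contDiffOn_succ_iff_deriv_of_isOpen isOpen_Ioi]
    refine ⟨fun t ht => (hT t ?_).differentiableWithinAt, fun h => ?_, hT'.mono ?_⟩
    · exact (le_max_left _ _).trans (le_of_lt ht)
    · exact absurd h (by simp)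
    · exact Set.Ioi_subset_Ioi (le_max_right _ _)

/-- The derivative has eventually constant sign, so the function is eventually monotone. -/
theorem exists_limit (hH : IsHardyField H) (hf : (f : Germ (atTop : Filter ℝ) ℝ) ∈ H) :
    Tendsto f atTop atTop ∨ Tendsto f atTop atBot ∨ ∃ l, Tendsto f atTop (𝓝 l) := by
  have hd := hH.differentiable f hf
  rcases hH.eventually_le_or_lt (hH.deriv_mem f hf) with h | h
  · obtain ⟨T, hT⟩ := exists_monotoneOn_Ici hd h
    rcases hT.tendsto_atTop_or_exists with h1 | h1
    · exact Or.inl h1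
    · exact Or.inr (Or.inr h1)
  · obtain ⟨T, hT⟩ := exists_antitoneOn_Ici hd (h.mono fun t ht => ht.le)
    rcases hT.neg.tendsto_atTop_or_exists with h1 | ⟨l, h1⟩
    · exact Or.inr (Or.inl (tendsto_neg_atTop_iff.1 h1))
    · refine Or.inr (Or.inr ⟨-l, ?_⟩)
      simpa using h1.neg

/-- A positive element tending to zero is eventually decreasing. -/
theorem eventually_deriv_neg (hH : IsHardyField H) (hf : (f : Germ (atTop : Filter ℝ) ℝ) ∈ H)
    (hpos : ∀ᶠ t in atTop, 0 < f t) (h0 : Tendsto f atTop (𝓝 0)) :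
    ∀ᶠ t in atTop, deriv f t < 0 := by
  rcases hH.eventually_le_or_lt (hH.deriv_mem f hf) with h | h
  · obtain ⟨T, hT⟩ := exists_monotoneOn_Ici (hH.differentiable f hf) h
    obtain ⟨t, ht, htT⟩ := (hpos.and (eventually_ge_atTop T)).exists
    exact absurd (hT.le_of_tendsto_atTop h0 htT) (not_le.2 ht)
  · exact h

/-- Integrate the bound m times; the gap between `K'` and `K` absorbs the constants of integration.
-/
theorem eventually_mul_pow_le (hH : IsHardyField H) (m : ℕ) :
    ∀ {f : ℝ → ℝ}, (f : Germ (atTop : Filter ℝ) ℝ) ∈ H → ∀ {K K' : ℝ},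
      (∀ᶠ t in atTop, (m.factorial : ℝ) * K ≤ iteratedDeriv m f t) → K' < K →
      ∀ᶠ t in atTop, K' * t ^ m ≤ f t := by
  induction m with
  | zero =>
    intro f _ K K' h hK
    filter_upwards [h] with t ht
    simp at ht ⊢
    linarith
  | succ m ih =>
    intro f hf K K' h hK
    obtain ⟨L, hL1, hL2⟩ := exists_between hK
    have hder : ∀ᶠ t in atTop, (m + 1 : ℝ) * L * t ^ m ≤ deriv f t := by
      refine ih (hH.deriv_mem f hf) (K := (m + 1 : ℝ) * K) ?_ (by gcongr)
      filter_upwards [h] with t ht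
      rw [← iteratedDeriv_succ']
      rw [Nat.factorial_succ] at ht
      push_cast at ht
      linarith
    have hd := hH.differentiable f hf
    have hpd : ∀ t : ℝ, HasDerivAt (fun t : ℝ => L * t ^ (m + 1)) (L * ((m + 1 : ℕ) * t ^ m)) t :=
      fun t => (hasDerivAt_pow (m + 1) t).const_mul L
    obtain ⟨T, hT⟩ := exists_monotoneOn_Ici (f := fun t => f t - L * t ^ (m + 1))
      (hd.mono fun t ht => ht.sub (hpd t).differentiableAt) (by
        filter_upwards [hd, hder] with t ht1 ht2
        rw [(ht1.hasDerivAt.fun_sub (hpd t)).deriv]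
        push_cast
        linarith)
    have hpow : Tendsto (fun t : ℝ => (L - K') * t ^ (m + 1)) atTop atTop :=
      (tendsto_pow_atTop (Nat.succ_ne_zero m)).const_mul_atTop (sub_pos.2 hL1)
    filter_upwards [eventually_ge_atTop T,
      hpow.eventually_ge_atTop (-(f T - L * T ^ (m + 1)))] with t ht1 ht2
    have := hT (Set.mem_Ici.2 le_rfl) (Set.mem_Ici.2 ht1) ht1
    simp only at this
    linarith

theorem eventually_le_mul_pow (hH : IsHardyField H) (m : ℕ)
    (hf : (f : Germ (atTop : Filter ℝ) ℝ) ∈ H) {K K' : ℝ}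
    (h : ∀ᶠ t in atTop, iteratedDeriv m f t ≤ (m.factorial : ℝ) * K) (hK : K < K') :
    ∀ᶠ t in atTop, f t ≤ K' * t ^ m := by
  have := hH.eventually_mul_pow_le m (neg_mem hf) (K := -K) (K' := -K') (by
    filter_upwards [h] with t ht
    rw [iteratedDeriv_fun_neg]
    linarith) (by linarith)
  filter_upwards [this] with t ht
  linarith

/-- A converse of l'Hôpital's rule: in a Hardy field the m-th derivative has some limit in [−∞, ∞],
and a value other than m!ρ would, after integration, contradict the growth of f. -/
theorem tendsto_iteratedDeriv (hH : IsHardyField H) (m : ℕ)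
    (hf : (f : Germ (atTop : Filter ℝ) ℝ) ∈ H) {ρ : ℝ}
    (h : Tendsto (fun t => f t / t ^ m) atTop (𝓝 ρ)) :
    Tendsto (iteratedDeriv m f) atTop (𝓝 (m.factorial * ρ)) := by
  have hm : (0 : ℝ) < m.factorial := by exact_mod_cast m.factorial_pos
  have hup : ∀ K, ρ < K → ¬ ∀ᶠ t in atTop, (m.factorial : ℝ) * K ≤ iteratedDeriv m f t := by
    intro K hK hev
    obtain ⟨L, hL1, hL2⟩ := exists_between hK
    have := hH.eventually_mul_pow_le m hf hev hL2
    refine absurd (ge_of_tendsto h ?_) (not_le.2 hL1)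
    filter_upwards [this, eventually_gt_atTop 0] with t ht ht0
    rwa [le_div_iff₀ (by positivity)]
  have hlo : ∀ K, K < ρ → ¬ ∀ᶠ t in atTop, iteratedDeriv m f t ≤ (m.factorial : ℝ) * K := by
    intro K hK hev
    obtain ⟨L, hL1, hL2⟩ := exists_between hK
    have := hH.eventually_le_mul_pow m hf hev hL1
    refine absurd (le_of_tendsto h ?_) (not_le.2 hL2)
    filter_upwards [this, eventually_gt_atTop 0] with t ht ht0
    rwa [div_le_iff₀ (by positivity)]
  rcases hH.exists_limit (hH.iteratedDeriv_mem hf m) with hl | hl | ⟨l, hl⟩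
  · exact absurd (hl.eventually_ge_atTop _) (hup (ρ + 1) (by linarith))
  · exact absurd (hl.eventually_le_atBot _) (hlo (ρ - 1) (by linarith))
  · suffices l = m.factorial * ρ by rwa [← this]
    by_contra hne
    rcases lt_or_gt_of_ne hne with hlt | hgt
    · obtain ⟨x, hx1, hx2⟩ := exists_between hlt
      refine hlo (x / m.factorial) ?_ ?_
      · rw [div_lt_iff₀ hm]; linarith
      · filter_upwards [hl.eventually_lt_const hx1] with t ht
        rw [mul_div_cancel₀ _ hm.ne']
        exact ht.le
    · obtain ⟨x, hx1, hx2⟩ := exists_between hgt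
      refine hup (x / m.factorial) ?_ ?_
      · rw [lt_div_iff₀ hm]; linarith
      · filter_upwards [hl.eventually_const_lt hx2] with t ht
        rw [mul_div_cancel₀ _ hm.ne']
        exact ht.le

theorem tendsto_deriv_zero (hH : IsHardyField H) (hf : (f : Germ (atTop : Filter ℝ) ℝ) ∈ H)
    {l : ℝ} (h : Tendsto f atTop (𝓝 l)) : Tendsto (deriv f) atTop (𝓝 0) := by
  have := hH.tendsto_iteratedDeriv 1 hf (ρ := 0) (by
    simpa using h.div_atTop tendsto_id)
  simpa [iteratedDeriv_one] using this

/-- By the mean value theorem the slope is a value of the derivative beyond t. The filter `l` is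
arbitrary so as to cover finite and infinite limits at once. -/
theorem tendsto_slope (hH : IsHardyField H) (hf : (f : Germ (atTop : Filter ℝ) ℝ) ∈ H)
    {l : Filter ℝ} (h : Tendsto (deriv f) atTop l) {δ : ℝ} (hδ : 0 < δ) :
    Tendsto (fun t => fwdDiff δ f t / δ) atTop l := by
  intro s hs
  rw [mem_map]
  obtain ⟨T, hT⟩ := eventually_atTop.1 ((h.eventually hs).and (hH.differentiable f hf))
  filter_upwards [eventually_ge_atTop T] with t ht
  obtain ⟨c, hc, hc'⟩ := exists_deriv_eq_slope f (show t < t + δ by linarith)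
    (fun x hx => (hT x (ht.trans hx.1)).2.continuousAt.continuousWithinAt)
    (fun x hx => (hT x (ht.trans hx.1.le)).2.differentiableWithinAt)
  have := (hT c (ht.trans hc.1.le)).1
  rw [hc', add_sub_cancel_left] at this
  exact this

theorem iteratedDeriv_fwdDiff (hH : IsHardyField H) (hf : (f : Germ (atTop : Filter ℝ) ℝ) ∈ H)
    (m : ℕ) (δ : ℝ) :
    iteratedDeriv m (fwdDiff δ f) =ᶠ[atTop] fwdDiff δ (iteratedDeriv m f) := by
  have h1 := hH.eventually_contDiffAt hf m
  have h2 := hH.eventually_contDiffAt (hH.translate_mem f hf δ) m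
  filter_upwards [h1, h2] with t ht1 ht2
  have : fwdDiff δ f = (fun t => f (t + δ)) - f := rfl
  rw [this, iteratedDeriv_sub ht2 ht1, iteratedDeriv_comp_add_const]
  rfl

theorem tendsto_iteratedDeriv_fwdDiff (hH : IsHardyField H)
    (hf : (f : Germ (atTop : Filter ℝ) ℝ) ∈ H) (m : ℕ) {l : Filter ℝ}
    (h : Tendsto (iteratedDeriv (m + 1) f) atTop l) {δ : ℝ} (hδ : 0 < δ) :
    Tendsto (fun t => iteratedDeriv m (fwdDiff δ f) t / δ) atTop l := by
  rw [iteratedDeriv_succ] at h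
  refine (hH.tendsto_slope (hH.iteratedDeriv_mem hf m) h hδ).congr' ?_
  filter_upwards [hH.iteratedDeriv_fwdDiff hf m δ] with t ht
  rw [ht]

theorem not_tendsto_atTop_of_deriv_nonpos (hd : ∀ᶠ t in atTop, DifferentiableAt ℝ f t)
    (h : ∀ᶠ t in atTop, deriv f t ≤ 0) : ¬ Tendsto f atTop atTop := by
  intro hf
  obtain ⟨T, hT⟩ := exists_antitoneOn_Ici hd h
  obtain ⟨t, ht, htT⟩ := ((hf.eventually_gt_atTop (f T)).and (eventually_ge_atTop T)).exists
  exact absurd (hT (Set.mem_Ici.2 le_rfl) (Set.mem_Ici.2 htT) htT) (not_le.2 ht)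

/-- If the antiderivative `g` of `w` tends to infinity, then `w` cannot decay faster than a power
slightly smaller than `t ^ (-1)`. -/
theorem exists_monotoneOn_pow_mul (hH : IsHardyField H)
    (hg : (g : Germ (atTop : Filter ℝ) ℝ) ∈ H) (hg1 : Tendsto g atTop atTop)
    (hg2 : Tendsto (deriv g) atTop (𝓝 0)) :
    (∀ᶠ t in atTop, 0 < deriv g t) ∧
      ∃ T, MonotoneOn (fun t => deriv g t ^ 4 * t ^ 5) (Set.Ici T) := by
  have hw := hH.deriv_mem g hg
  have hgd := hH.differentiable g hg
  have hwd := hH.differentiable _ hw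
  set w := deriv g with hwdef
  have hwpos : ∀ᶠ t in atTop, 0 < w t := by
    rcases hH.eventually_trichotomy hw with h | h | h
    · exact absurd hg1 (not_tendsto_atTop_of_deriv_nonpos hgd (h.mono fun t ht => ht.le))
    · exact h
    · exact absurd hg1 (not_tendsto_atTop_of_deriv_nonpos hgd (h.mono fun t ht => ht.le))
  refine ⟨hwpos, ?_⟩
  have hw'neg := hH.eventually_deriv_neg hw hwpos hg2
  have hw' := hH.deriv_mem w hw
  have hw'ne : (deriv w : Germ (atTop : Filter ℝ) ℝ) ≠ 0 := fun h0 => by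
    have : ∀ᶠ t in atTop, deriv w t = 0 := Germ.coe_eq.1 h0
    obtain ⟨t, ht1, ht2⟩ := (this.and hw'neg).exists
    linarith
  obtain ⟨y, hyH, hy⟩ := hH.exists_inv _ hw' hw'ne
  induction y using Germ.inductionOn with | _ Y =>
  have hY : ∀ᶠ t in atTop, deriv w t * Y t = 1 := Germ.coe_eq.1 hy
  -- Here v = −w/w'. A linear lower bound on v is an upper bound on the logarithmic decay rate of w.
  set v : ℝ → ℝ := fun t => -(w t * Y t) with hv
  have hvH : (v : Germ (atTop : Filter ℝ) ℝ) ∈ H := neg_mem (mul_mem hw hyH)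
  have hvw : ∀ᶠ t in atTop, deriv w t * v t = -w t := by
    filter_upwards [hY] with t ht
    rw [hv]
    linear_combination (-w t) * ht
  have hvpos : ∀ᶠ t in atTop, 0 < v t := by
    filter_upwards [hvw, hwpos, hw'neg] with t h1 h2 h3
    by_contra hcon
    nlinarith [mul_nonneg_of_nonpos_of_nonpos h3.le (not_lt.1 hcon)]
  have hvd := hH.differentiable v hvH
  have hv' := hH.deriv_mem v hvH
  -- Compare v' with 9/10, cleared of denominators because integer constants lie in any subring. The
  -- value is below 1 for the contradiction and above 4/5 to give the exponent 5/4.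
  rcases hH.eventually_le_or_lt (sub_mem (intCast_mul_mem 10 hv') (intCast_mem 9)) with h | h
  · -- `v` grows at least linearly
    have hvlow : ∀ᶠ t in atTop, 4 / 5 * t ≤ v t := by
      obtain ⟨T, hT⟩ := exists_monotoneOn_Ici (f := fun t => v t - 9 / 10 * t)
        (hvd.mono fun t ht => ht.sub (differentiableAt_id.const_mul _)) (by
          filter_upwards [hvd, h] with t ht1 ht2
          have h9 : HasDerivAt (fun t : ℝ => 9 / 10 * t) (9 / 10 * 1) t :=
            (hasDerivAt_id t).const_mul _
          rw [(ht1.hasDerivAt.fun_sub h9).deriv]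
          push_cast at ht2
          linarith)
      filter_upwards [eventually_ge_atTop T,
        eventually_ge_atTop (-10 * (v T - 9 / 10 * T))] with t ht1 ht2
      have := hT (Set.mem_Ici.2 le_rfl) (Set.mem_Ici.2 ht1) ht1
      simp only at this
      linarith
    refine exists_monotoneOn_Ici (hwd.mono fun t ht => ?_) ?_
    · exact (ht.pow 4).mul (differentiableAt_id.pow 5)
    · filter_upwards [hwd, hvlow, hwpos, hw'neg, hvw, eventually_gt_atTop 0]
        with t h1 h2 h3 h4 h5 h6
      rw [((h1.hasDerivAt.fun_pow 4).fun_mul (hasDerivAt_pow 5 t)).deriv]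
      have h7 : 0 ≤ 4 * deriv w t * t + 5 * w t := by nlinarith
      have h8 : 0 ≤ w t ^ 3 * t ^ 4 * (4 * deriv w t * t + 5 * w t) := by positivity
      norm_num
      linarith
  · exfalso
    -- From w'v = −w one gets (g + 10wv)' = w(10v' − 9) < 0, although g + 10wv ≥ g → ∞.
    refine not_tendsto_atTop_of_deriv_nonpos (f := fun t => g t + 10 * (w t * v t)) ?_ ?_ ?_
    · filter_upwards [hgd, hwd, hvd] with t h1 h2 h3
      exact h1.add ((h2.mul h3).const_mul _)
    · filter_upwards [hgd, hwd, hvd, hwpos, hvw, h] with t h1 h2 h3 h4 h5 h6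
      rw [(h1.hasDerivAt.fun_add ((h2.hasDerivAt.fun_mul h3.hasDerivAt).const_mul 10)).deriv]
      push_cast at h6
      have : w t * (10 * deriv v t - 9) ≤ 0 := mul_nonpos_of_nonneg_of_nonpos h4.le h6.le
      rw [h5, ← hwdef]
      linarith
    · refine tendsto_atTop_mono' _ ?_ hg1
      filter_upwards [hwpos, hvpos] with t h1 h2
      have := mul_pos h1 h2
      linarith

end IsHardyField

/-! ### Exponential sums of Hardy field functions. -/

/-- The limit of `f` at infinity is infinite or irrational. -/
def HasNonresonantLimit (f : ℝ → ℝ) : Prop :=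
  Tendsto f atTop atTop ∨ Tendsto f atTop atBot ∨ ∃ β, Irrational β ∧ Tendsto f atTop (𝓝 β)

theorem HasNonresonantLimit.congr {f g : ℝ → ℝ} (hf : HasNonresonantLimit f)
    (h : f =ᶠ[atTop] g) : HasNonresonantLimit g := by
  rcases hf with hf | hf | ⟨β, hβ, hf⟩
  · exact Or.inl (hf.congr' h)
  · exact Or.inr (Or.inl (hf.congr' h))
  · exact Or.inr (Or.inr ⟨β, hβ, hf.congr' h⟩)

theorem HasNonresonantLimit.intCast_mul {f : ℝ → ℝ} (hf : HasNonresonantLimit f) {k : ℤ}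
    (hk : k ≠ 0) : HasNonresonantLimit (fun t => k * f t) := by
  have hk' : (k : ℝ) ≠ 0 := by exact_mod_cast hk
  rcases hf with hf | hf | ⟨β, hβ, hf⟩
  · rcases lt_or_gt_of_ne hk' with h | h
    · exact Or.inr (Or.inl (hf.const_mul_atTop_of_neg h))
    · exact Or.inl (hf.const_mul_atTop h)
  · rcases lt_or_gt_of_ne hk' with h | h
    · exact Or.inl (hf.const_mul_atBot_of_neg h)
    · exact Or.inr (Or.inl (hf.const_mul_atBot h))
  · exact Or.inr (Or.inr ⟨k * β, hβ.intCast_mul hk, hf.const_mul _⟩)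

theorem HasNonresonantLimit.add_zero {f g : ℝ → ℝ} (hf : HasNonresonantLimit f)
    (hg : Tendsto g atTop (𝓝 0)) : HasNonresonantLimit (fun t => f t + g t) := by
  rcases hf with hf | hf | ⟨β, hβ, hf⟩
  · exact Or.inl (hf.atTop_add hg)
  · exact Or.inr (Or.inl (hf.atBot_add hg))
  · exact Or.inr (Or.inr ⟨β, hβ, by simpa using hf.add hg⟩)

/-- If the differences of `x` converge to an irrational number, then `∑ 𝐞 (x n)` is `o(N)`. -/
theorem meanZero_fourierChar_of_tendsto_irrational {x : ℕ → ℝ} {β : ℝ} (hβ : Irrational β)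
    (h : Tendsto (fun n => x (n + 1) - x n) atTop (𝓝 β)) :
    MeanZero (fun n => (𝐞 (x n) : ℂ)) := by
  have hne : (𝐞 β : ℂ) - 1 ≠ 0 := by
    intro h0
    rw [sub_eq_zero, Circle.coe_eq_one, Real.fourierChar_apply', Circle.exp_eq_one] at h0
    obtain ⟨n, hn⟩ := h0
    refine hβ ⟨n, ?_⟩
    have : 2 * π * β = 2 * π * n := by linarith
    simpa using (mul_left_cancel₀ Real.two_pi_pos.ne' this).symm
  have hcont : Continuous (fun t : ℝ => (𝐞 t : ℂ)) :=
    continuous_subtype_val.comp Real.continuous_fourierChar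
  have h1 : Tendsto (fun n => ‖(𝐞 (x (n + 1) - x n) : ℂ) - 𝐞 β‖) atTop (𝓝 0) := by
    have := ((hcont.tendsto β).comp h).sub_const (𝐞 β : ℂ)
    simpa using this.norm
  have h2 : Tendsto (fun n => (𝐞 β : ℂ) * 𝐞 (x n) - 𝐞 (x (n + 1))) atTop (𝓝 0) := by
    rw [tendsto_zero_iff_norm_tendsto_zero]
    refine h1.congr fun n => ?_
    have : (𝐞 (x (n + 1)) : ℂ) = 𝐞 (x (n + 1) - x n) * 𝐞 (x n) := by
      rw [← Circle.coe_mul, ← AddChar.map_add_eq_mul, sub_add_cancel]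
    rw [this, ← sub_mul, norm_mul, Circle.norm_coe, mul_one, norm_sub_rev]
  -- Adding the telescoping z(n+1) − z(n) to the null sequence 𝐞(β)z(n) − z(n+1) leaves (𝐞(β) −
  -- 1)z(n).
  have h3 := (meanZero_shift_sub (z := fun n => (𝐞 (x n) : ℂ)) (C := 1)
    fun n => (Circle.norm_coe _).le).add (meanZero_of_tendsto h2)
  have h4 := h3.const_mul ((𝐞 β : ℂ) - 1)⁻¹
  convert h4 using 2 with n
  field_simp
  ring

namespace IsHardyField

variable {H : Subring (Germ (atTop : Filter ℝ) ℝ)} {f g : ℝ → ℝ}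

/-- Two mean value theorems put the second difference at t between g''(t+2) and g''(t). It is itself
a positive Hardy field element tending to 0, hence eventually decreasing. -/
theorem meanZero_fourierChar_of_deriv_atTop (hH : IsHardyField H)
    (hg : (g : Germ (atTop : Filter ℝ) ℝ) ∈ H) (h1 : Tendsto (deriv g) atTop atTop)
    (h2 : Tendsto (deriv (deriv g)) atTop (𝓝 0)) :
    MeanZero (fun n : ℕ => (𝐞 (g n) : ℂ)) := by
  have hg' := hH.deriv_mem g hg
  have hg'' := hH.deriv_mem _ hg'
  obtain ⟨hpos, T₁, hT₁⟩ := hH.exists_monotoneOn_pow_mul hg' h1 h2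
  obtain ⟨T₂, hT₂⟩ := exists_antitoneOn_Ici (hH.differentiable _ hg'')
    ((hH.eventually_deriv_neg hg'' hpos h2).mono fun t ht => ht.le)
  set r : ℝ → ℝ := fwdDiff 1 (fwdDiff 1 g) with hr
  have hrH : (r : Germ (atTop : Filter ℝ) ℝ) ∈ H := hH.fwdDiff_mem (hH.fwdDiff_mem hg 1) 1
  obtain ⟨T₃, hT₃⟩ := eventually_atTop.1
    ((hH.differentiable _ hg).and ((hH.differentiable _ hg').and hpos))
  set T := max T₁ (max T₂ T₃) with hT
  have hTT₁ : T₁ ≤ T := le_max_left _ _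
  have hTT₂ : T₂ ≤ T := (le_max_left _ _).trans (le_max_right _ _)
  have hTT₃ : T₃ ≤ T := (le_max_right _ _).trans (le_max_right _ _)
  have hbound : ∀ t ≥ T, deriv (deriv g) (t + 2) ≤ r t ∧ r t ≤ deriv (deriv g) t := by
    intro t ht
    have hφ : ∀ s ≥ T, HasDerivAt (fwdDiff 1 g) (deriv g (s + 1) - deriv g s) s := fun s hs => by
      have e1 := (hT₃ (s + 1) (by linarith)).1.hasDerivAt.comp_add_const s 1
      exact e1.fun_sub (hT₃ s (by linarith)).1.hasDerivAt
    obtain ⟨c, hc, hc'⟩ := exists_deriv_eq_slope (fwdDiff 1 g) (show t < t + 1 by linarith)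
      (fun x hx => (hφ x (le_trans ht hx.1)).continuousAt.continuousWithinAt)
      (fun x hx => (hφ x (le_trans ht hx.1.le)).differentiableAt.differentiableWithinAt)
    have hcT : T ≤ c := le_trans ht hc.1.le
    obtain ⟨c', hc1, hc2⟩ := exists_deriv_eq_slope (deriv g) (show c < c + 1 by linarith)
      (fun x hx => (hT₃ x (by linarith [hx.1])).2.1.continuousAt.continuousWithinAt)
      (fun x hx => (hT₃ x (by linarith [hx.1])).2.1.differentiableWithinAt)
    have e : r t = deriv (deriv g) c' := by
      rw [hc2, add_sub_cancel_left, div_one, ← (hφ c hcT).deriv, hc', add_sub_cancel_left, div_one]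
      rfl
    rw [e]
    have ht' : T ≤ t := ht
    exact ⟨hT₂ (Set.mem_Ici.2 (by linarith [hc1.1])) (Set.mem_Ici.2 (by linarith))
        (by linarith [hc1.2, hc.2]),
      hT₂ (Set.mem_Ici.2 (by linarith)) (Set.mem_Ici.2 (by linarith [hc1.1]))
        (by linarith [hc1.1, hc.1])⟩
  have hrpos : ∀ᶠ t in atTop, 0 < r t := by
    filter_upwards [eventually_ge_atTop T] with t ht
    exact (hT₃ (t + 2) (by linarith)).2.2.trans_le (hbound t ht).1
  have hr0 : Tendsto r atTop (𝓝 0) := by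
    refine tendsto_of_tendsto_of_tendsto_of_le_of_le' tendsto_const_nhds h2
      (hrpos.mono fun t ht => ht.le) ?_
    filter_upwards [eventually_ge_atTop T] with t ht
    exact (hbound t ht).2
  obtain ⟨T₄, hT₄⟩ := exists_antitoneOn_Ici (hH.differentiable _ hrH)
    ((hH.eventually_deriv_neg hrH hrpos hr0).mono fun t ht => ht.le)
  obtain ⟨n₀, hn₀⟩ := exists_nat_ge (max T T₄)
  have hnT : ∀ n : ℕ, n₀ ≤ n → T ≤ n := fun n hn =>
    (le_max_left _ _).trans (hn₀.trans (by exact_mod_cast hn))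
  have hnT₄ : ∀ n : ℕ, n₀ ≤ n → T₄ ≤ n := fun n hn =>
    (le_max_right _ _).trans (hn₀.trans (by exact_mod_cast hn))
  have hrn : ∀ n : ℕ, g ((n + 2 : ℕ) : ℝ) - 2 * g ((n + 1 : ℕ) : ℝ) + g n = r n := fun n => by
    simp only [hr, fwdDiff]
    push_cast
    rw [show (n : ℝ) + 1 + 1 = n + 2 by ring]
    ring
  refine meanZero_fourierChar_of_secondDiff (x := fun n : ℕ => g n)
    (w := fun n : ℕ => deriv (deriv g) n) (n₀ := n₀) (fun n hn => ?_) (fun m n hm hmn => ?_)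
    (h2.comp tendsto_natCast_atTop_atTop) (fun m n hm hmn => ?_) (fun n hn => ?_) (fun n hn => ?_)
    (fun n hn => ?_)
  · exact (hT₃ n (hTT₃.trans (hnT n hn))).2.2
  · exact hT₂ (Set.mem_Ici.2 (hTT₂.trans (hnT m hm)))
      (Set.mem_Ici.2 (hTT₂.trans (hnT n (hm.trans hmn)))) (by exact_mod_cast hmn)
  · exact hT₁ (Set.mem_Ici.2 (hTT₁.trans (hnT m hm)))
      (Set.mem_Ici.2 (hTT₁.trans (hnT n (hm.trans hmn)))) (by exact_mod_cast hmn)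
  · rw [hrn]
    exact_mod_cast (hbound n (hnT n hn)).1
  · rw [hrn]
    exact (hbound n (hnT n hn)).2
  · rw [hrn n, show n + 3 = n + 1 + 2 by ring, show n + 2 = n + 1 + 1 by ring, hrn (n + 1)]
    exact hT₄ (Set.mem_Ici.2 (hnT₄ n hn)) (Set.mem_Ici.2 (hnT₄ (n + 1) (by omega)))
      (by push_cast; linarith)

theorem meanZero_fourierChar_of_deriv (hH : IsHardyField H)
    (hg : (g : Germ (atTop : Filter ℝ) ℝ) ∈ H) (h1 : HasNonresonantLimit (deriv g))
    (h2 : Tendsto (deriv (deriv g)) atTop (𝓝 0)) :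
    MeanZero (fun n : ℕ => (𝐞 (g n) : ℂ)) := by
  rcases h1 with h1 | h1 | ⟨β, hβ, h1⟩
  · exact hH.meanZero_fourierChar_of_deriv_atTop hg h1 h2
  · have e : deriv (fun t => -g t) = fun t => -deriv g t := by ext t; simp
    have := (hH.meanZero_fourierChar_of_deriv_atTop (neg_mem hg)
      (by rw [e]; exact tendsto_neg_atTop_iff.2 h1)
      (by
        have e2 : deriv (fun t => -deriv g t) = fun t => -deriv (deriv g) t := by ext t; simp
        rw [e, e2]
        simpa using h2.neg)).conj
    simpa [← Circle.coe_inv_eq_conj, AddChar.map_neg_eq_inv] using this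
  · refine meanZero_fourierChar_of_tendsto_irrational hβ ?_
    have := (hH.tendsto_slope hg h1 one_pos).comp tendsto_natCast_atTop_atTop
    refine this.congr fun n => ?_
    simp [fwdDiff]

/-- Weyl sums of Hardy field functions of polynomial growth. -/
theorem meanZero_fourierChar (hH : IsHardyField H) (i : ℕ) :
    ∀ {g : ℝ → ℝ}, (g : Germ (atTop : Filter ℝ) ℝ) ∈ H →
      HasNonresonantLimit (iteratedDeriv (i + 1) g) →
      Tendsto (iteratedDeriv (i + 2) g) atTop (𝓝 0) →
      MeanZero (fun n : ℕ => (𝐞 (g n) : ℂ)) := by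
  induction i with
  | zero =>
    intro g hg h1 h2
    refine hH.meanZero_fourierChar_of_deriv hg ?_ ?_
    · simpa [iteratedDeriv_one] using h1
    · simpa [iteratedDeriv_succ] using h2
  | succ i ih =>
    intro g hg h1 h2
    refine meanZero_of_correlations (fun n => (Circle.norm_coe _).le) fun k hk => ?_
    have hk' : (0 : ℝ) < k := by exact_mod_cast hk
    have e : ∀ n : ℕ, (𝐞 (g ((n + k : ℕ) : ℝ)) : ℂ) * (starRingEnd ℂ) (𝐞 (g n) : ℂ) =
        𝐞 (fwdDiff (k : ℝ) g n) := fun n => by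
      rw [← Circle.coe_inv_eq_conj, ← Circle.coe_mul, ← AddChar.map_neg_eq_inv,
        ← AddChar.map_add_eq_mul, fwdDiff, sub_eq_add_neg]
      push_cast
      rfl
    simp only [e]
    refine ih (hH.fwdDiff_mem hg (k : ℝ)) ?_ ?_
    -- Divided by the lag k, the difference trades one order of derivative for the same limit;
    -- multiplying back by k ≠ 0 preserves nonresonance.
    · have : HasNonresonantLimit (fun t => iteratedDeriv (i + 1) (fwdDiff (k : ℝ) g) t / k) := by
        rcases h1 with h1 | h1 | ⟨β, hβ, h1⟩
        · exact Or.inl (hH.tendsto_iteratedDeriv_fwdDiff hg (i + 1) h1 hk')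
        · exact Or.inr (Or.inl (hH.tendsto_iteratedDeriv_fwdDiff hg (i + 1) h1 hk'))
        · exact Or.inr (Or.inr ⟨β, hβ, hH.tendsto_iteratedDeriv_fwdDiff hg (i + 1) h1 hk'⟩)
      refine (this.intCast_mul (k := k) (by exact_mod_cast hk.ne')).congr (.of_forall fun t => ?_)
      simp only [Int.cast_natCast]
      field_simp
    · have := (hH.tendsto_iteratedDeriv_fwdDiff hg (i + 2) h2 hk').const_mul (k : ℝ)
      rw [mul_zero] at this
      refine this.congr fun t => ?_
      field_simp

/-- The derivatives of a Hardy field function satisfying the growth condition. -/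
theorem nonresonant_of_growth (hH : IsHardyField H)
    (hf : (f : Germ (atTop : Filter ℝ) ℝ) ∈ H) (d : ℕ)
    (hgrowth :
      ((fun t : ℝ => t ^ d) =o[atTop] f ∧ f =o[atTop] (fun t : ℝ => t ^ (d + 1))) ∨
      ∃ α : ℝ, Irrational α ∧ (fun t : ℝ => f t - t ^ d * α) =o[atTop] (fun t : ℝ => t ^ d)) :
    HasNonresonantLimit (iteratedDeriv d f) ∧
      ∀ m, d < m → Tendsto (iteratedDeriv m f) atTop (𝓝 0) := by
  have hstep : Tendsto (iteratedDeriv (d + 1) f) atTop (𝓝 0) →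
      ∀ m, d < m → Tendsto (iteratedDeriv m f) atTop (𝓝 0) := by
    intro h m hm
    induction m, hm using Nat.le_induction with
    | base => exact h
    | succ m _ ih =>
      rw [iteratedDeriv_succ]
      exact hH.tendsto_deriv_zero (hH.iteratedDeriv_mem hf m) ih
  rcases hgrowth with ⟨h1, h2⟩ | ⟨α, hα, h⟩
  · refine ⟨?_, hstep ?_⟩
    · rcases hH.exists_limit (hH.iteratedDeriv_mem hf d) with hl | hl | ⟨l, hl⟩
      · exact Or.inl hl
      · exact Or.inr (Or.inl hl)
      · exfalso
        -- A finite limit of the d-th derivative would give f = O(t^d), against t^d ≺ f.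
        have hd : (0 : ℝ) < d.factorial := by exact_mod_cast d.factorial_pos
        have hup := hH.eventually_le_mul_pow d hf (K := (l + 1) / d.factorial)
          (K' := (l + 1) / d.factorial + 1) (by
            filter_upwards [hl.eventually_lt_const (lt_add_one l)] with t ht
            rw [mul_div_cancel₀ _ hd.ne']
            exact ht.le) (by linarith)
        have hlo := hH.eventually_mul_pow_le d hf (K := (l - 1) / d.factorial)
          (K' := (l - 1) / d.factorial - 1) (by
            filter_upwards [hl.eventually_const_lt (sub_one_lt l)] with t ht
            rw [mul_div_cancel₀ _ hd.ne']
            exact ht.le) (by linarith)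
        have hO : f =O[atTop] (fun t : ℝ => t ^ d) := by
          refine IsBigO.of_bound
            (|(l + 1) / d.factorial + 1| + |(l - 1) / d.factorial - 1|) ?_
          filter_upwards [hup, hlo, eventually_gt_atTop 0] with t h1 h2 h3
          have hp : (0 : ℝ) < t ^ d := by positivity
          rw [Real.norm_of_nonneg hp.le, Real.norm_eq_abs, abs_le]
          constructor
          · have e1 := neg_abs_le ((l - 1) / d.factorial - 1)
            have e2 := abs_nonneg ((l + 1) / d.factorial + 1)
            nlinarith
          · have e1 := le_abs_self ((l + 1) / d.factorial + 1)
            have e2 := abs_nonneg ((l - 1) / d.factorial - 1)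
            nlinarith
        refine isLittleO_irrefl' (l := (atTop : Filter ℝ)) (f' := fun t : ℝ => t ^ d) ?_
          (h1.trans_isBigO hO)
        refine Eventually.frequently ?_
        filter_upwards [eventually_gt_atTop 0] with t ht
        exact norm_ne_zero_iff.2 (pow_pos ht d).ne'
    · have := hH.tendsto_iteratedDeriv (d + 1) hf (ρ := 0) h2.tendsto_div_nhds_zero
      simpa using this
  · have hα' : Tendsto (fun t => f t / t ^ d) atTop (𝓝 α) := by
      have := h.tendsto_div_nhds_zero.add_const α
      rw [zero_add] at this
      refine this.congr' ?_
      filter_upwards [eventually_gt_atTop 0] with t ht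
      field_simp
      ring
    refine ⟨Or.inr (Or.inr ⟨_, ?_, hH.tendsto_iteratedDeriv d hf hα'⟩), hstep ?_⟩
    · exact hα.natCast_mul d.factorial_ne_zero
    · have h0 := hH.tendsto_iteratedDeriv (d + 1) hf (ρ := 0) (by
        refine (hα'.div_atTop tendsto_id).congr fun t => ?_
        rw [id, div_div, pow_succ])
      simpa using h0

end IsHardyField

/-! ### Iterated differences in place of derivatives. -/

namespace IsHardyField

variable {H : Subring (Germ (atTop : Filter ℝ) ℝ)} {f g : ℝ → ℝ}

theorem fwdDiff_iter_mem (hH : IsHardyField H) (hf : (f : Germ (atTop : Filter ℝ) ℝ) ∈ H)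
    (j : ℕ) : ((fwdDiff 1)^[j] f : Germ (atTop : Filter ℝ) ℝ) ∈ H := by
  induction j generalizing f with
  | zero => exact hf
  | succ j ih => exact ih (hH.fwdDiff_mem hf 1)

theorem tendsto_iteratedDeriv_fwdDiff_iter (hH : IsHardyField H) (j : ℕ) :
    ∀ {f : ℝ → ℝ}, (f : Germ (atTop : Filter ℝ) ℝ) ∈ H → ∀ (m : ℕ) {l : Filter ℝ},
      Tendsto (iteratedDeriv (m + j) f) atTop l →
      Tendsto (iteratedDeriv m ((fwdDiff 1)^[j] f)) atTop l := by
  induction j with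
  | zero => intro f _ m l h; exact h
  | succ j ih =>
    intro f hf m l h
    refine ih (hH.fwdDiff_mem hf 1) m ?_
    have := hH.tendsto_iteratedDeriv_fwdDiff hf (m + j) h one_pos
    simpa using this

/-- Δf(t) = f'(c) with t < c < t + 1, and f' varies little there because f'' → 0. -/
theorem tendsto_fwdDiff_sub_deriv (hH : IsHardyField H)
    (hf : (f : Germ (atTop : Filter ℝ) ℝ) ∈ H) (h : Tendsto (deriv (deriv f)) atTop (𝓝 0)) :
    Tendsto (fun t => fwdDiff 1 f t - deriv f t) atTop (𝓝 0) := by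
  rw [Metric.tendsto_nhds]
  intro ε hε
  have hd := hH.differentiable f hf
  have hd' := hH.differentiable _ (hH.deriv_mem f hf)
  obtain ⟨T, hT⟩ := eventually_atTop.1
    (hd.and (hd'.and (Metric.tendsto_nhds.1 h (ε / 2) (by positivity))))
  filter_upwards [eventually_ge_atTop T] with t ht
  obtain ⟨c, hc, hc'⟩ := exists_deriv_eq_slope f (show t < t + 1 by linarith)
    (fun x hx => (hT x (ht.trans hx.1)).1.continuousAt.continuousWithinAt)
    (fun x hx => (hT x (ht.trans hx.1.le)).1.differentiableWithinAt)
  have e : fwdDiff 1 f t = deriv f c := by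
    rw [hc', add_sub_cancel_left, div_one]
    rfl
  have key := (convex_Ici T).norm_image_sub_le_of_norm_deriv_le (f := deriv f) (C := ε / 2)
    (fun x hx => (hT x hx).2.1)
    (fun x hx => by simpa using (hT x hx).2.2.le) (Set.mem_Ici.2 ht)
    (Set.mem_Ici.2 (ht.trans hc.1.le))
  rw [e, dist_zero_right]
  refine key.trans_lt ?_
  rw [Real.norm_of_nonneg (by linarith [hc.1])]
  nlinarith [hc.2]

/-- Peel off one difference: Δ^d(Δf) ≈ (Δf)^{(d)} = Δ(f^{(d)}) ≈ f^{(d+1)}. -/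
theorem tendsto_fwdDiff_iter_sub_iteratedDeriv (hH : IsHardyField H) (d : ℕ) :
    ∀ {f : ℝ → ℝ}, (f : Germ (atTop : Filter ℝ) ℝ) ∈ H →
      Tendsto (iteratedDeriv (d + 1) f) atTop (𝓝 0) →
      Tendsto (fun t => (fwdDiff 1)^[d] f t - iteratedDeriv d f t) atTop (𝓝 0) := by
  induction d with
  | zero => intro f _ _; simp
  | succ d ih =>
    intro f hf h
    have h1 := ih (hH.fwdDiff_mem hf 1)
      (by simpa using hH.tendsto_iteratedDeriv_fwdDiff hf (d + 1) h one_pos)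
    have h2 := hH.tendsto_fwdDiff_sub_deriv (hH.iteratedDeriv_mem hf d)
      (by simpa [iteratedDeriv_succ] using h)
    have h3 := h1.add h2
    rw [add_zero] at h3
    refine h3.congr' ?_
    filter_upwards [hH.iteratedDeriv_fwdDiff hf d 1] with t ht
    rw [ht, iteratedDeriv_succ, Function.iterate_succ_apply]
    ring

/-- Weyl sums of integer combinations of the iterated differences of a Hardy field function. -/
theorem meanZero_fourierChar_sum_fwdDiff (hH : IsHardyField H)
    (hf : (f : Germ (atTop : Filter ℝ) ℝ) ∈ H) (d : ℕ)
    (h1 : HasNonresonantLimit (iteratedDeriv d f))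
    (h2 : ∀ m, d < m → Tendsto (iteratedDeriv m f) atTop (𝓝 0))
    (k : Fin (d + 1) → ℤ) (hk : ∃ i, i ≠ 0 ∧ k i ≠ 0) :
    MeanZero (fun n : ℕ =>
      (𝐞 (∑ i : Fin (d + 1), k i * (fwdDiff 1)^[d - i] f n) : ℂ)) := by
  classical
  -- The last index with nonzero coefficient decides: in the i-th derivative of the sum its term
  -- alone survives, with the limit of k_i f^{(d)}.
  obtain ⟨i, hi, himax⟩ := Finset.exists_max_image
    ((Finset.univ : Finset (Fin (d + 1))).filter (fun i => k i ≠ 0)) id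
    (by obtain ⟨i, _, hi⟩ := hk; exact ⟨i, by simp [hi]⟩)
  have hki : k i ≠ 0 := (Finset.mem_filter.1 hi).2
  have hmax : ∀ j, i < j → k j = 0 := fun j hj => by
    by_contra hkj
    exact absurd (himax j (by simp [hkj])) (not_le.2 hj)
  obtain ⟨i', hi'⟩ : ∃ i' : ℕ, (i : ℕ) = i' + 1 := by
    refine Nat.exists_eq_succ_of_ne_zero fun h0 => ?_
    obtain ⟨j, hj0, hkj⟩ := hk
    refine hkj (hmax j ?_)
    rw [Fin.lt_def, h0]
    exact Nat.pos_of_ne_zero fun h => hj0 (Fin.ext h)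
  have hid : (i : ℕ) ≤ d := Nat.lt_succ_iff.1 i.2
  set F : Fin (d + 1) → ℝ → ℝ := fun j t => k j * (fwdDiff 1)^[d - j] f t with hF
  have hFH : ∀ j, (F j : Germ (atTop : Filter ℝ) ℝ) ∈ H := fun j =>
    intCast_mul_mem _ (hH.fwdDiff_iter_mem hf _)
  have hsum : ∀ m, iteratedDeriv m (fun t => ∑ j, F j t) =ᶠ[atTop]
      fun t => ∑ j, iteratedDeriv m (F j) t := by
    intro m
    have : ∀ᶠ t in atTop, ∀ j ∈ (Finset.univ : Finset (Fin (d + 1))), ContDiffAt ℝ m (F j) t :=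
      (eventually_all_finset _).2 fun j _ => hH.eventually_contDiffAt (hFH j) m
    filter_upwards [this] with t ht
    exact iteratedDeriv_fun_sum ht
  have hFder : ∀ m j, iteratedDeriv m (F j) =
      fun t => k j * iteratedDeriv m ((fwdDiff 1)^[d - j] f) t := fun m j => by
    ext t
    exact iteratedDeriv_const_mul_field _ _
  -- The m-th derivative of Δ^{d-j} f behaves like a derivative of order m + (d − j), which exceeds
  -- d once j < m.
  have hzero : ∀ (m : ℕ) (j : Fin (d + 1)), (i < j ∨ (j : ℕ) < m) → Tendsto (iteratedDeriv m (F j)) atTop (𝓝 0) := by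
    intro m j hj
    rw [hFder]
    rcases hj with hj | hj
    · simp [hmax j hj]
    · have := (hH.tendsto_iteratedDeriv_fwdDiff_iter (d - j) hf m
        (h2 (m + (d - j)) (by omega))).const_mul (k j : ℝ)
      simpa using this
  refine hH.meanZero_fourierChar i' (g := fun t => ∑ j, F j t) (sum_mem _ fun j _ => hFH j) ?_ ?_
  · rw [← hi']
    refine HasNonresonantLimit.congr ?_ (hsum i).symm
    have hmain : HasNonresonantLimit (iteratedDeriv i (F i)) := by
      rw [hFder]
      refine HasNonresonantLimit.intCast_mul ?_ hki
      have e : (i : ℕ) + (d - i) = d := by omega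
      have := fun {l : Filter ℝ} => hH.tendsto_iteratedDeriv_fwdDiff_iter (d - i) hf i (l := l)
      rw [e] at this
      rcases h1 with h1 | h1 | ⟨β, hβ, h1⟩
      · exact Or.inl (this h1)
      · exact Or.inr (Or.inl (this h1))
      · exact Or.inr (Or.inr ⟨β, hβ, this h1⟩)
    have hrest : Tendsto (fun t => ∑ j ∈ Finset.univ.erase i, iteratedDeriv i (F j) t) atTop
        (𝓝 0) := by
      have := tendsto_finsetSum (Finset.univ.erase i)
        (fun j hj => hzero i j ((lt_or_gt_of_ne (Finset.ne_of_mem_erase hj)).symm))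
      simpa using this
    refine (hmain.add_zero hrest).congr (.of_forall fun t => ?_)
    exact Finset.add_sum_erase _ (fun j => iteratedDeriv i (F j) t) (Finset.mem_univ i)
  · refine Tendsto.congr' (hsum (i' + 2)).symm ?_
    have := tendsto_finsetSum (Finset.univ : Finset (Fin (d + 1)))
      (fun j _ => hzero (i' + 2) j (by
        rcases lt_or_ge i j with h | h
        · exact Or.inl h
        · right
          have := Fin.le_def.1 h
          omega))
    simpa using this

end IsHardyField

/-! ### Weak-star limits and Weyl's criterion. -/

/-- The mean of `z 1, …, z N`. -/
noncomputable def prefixMean (z : ℕ → ℂ) (N : ℕ) : ℂ := (N : ℂ)⁻¹ * ∑ n ∈ Finset.Icc 1 N, z n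

theorem prefixMean_add (z w : ℕ → ℂ) (N : ℕ) :
    prefixMean (fun n => z n + w n) N = prefixMean z N + prefixMean w N := by
  simp [prefixMean, Finset.sum_add_distrib, mul_add]

theorem prefixMean_const_mul (c : ℂ) (z : ℕ → ℂ) (N : ℕ) :
    prefixMean (fun n => c * z n) N = c * prefixMean z N := by
  simp [prefixMean, ← Finset.mul_sum, mul_left_comm]

theorem norm_prefixMean_le {z : ℕ → ℂ} {C : ℝ} (hC : 0 ≤ C) (hz : ∀ n, ‖z n‖ ≤ C) (N : ℕ) :
    ‖prefixMean z N‖ ≤ C := by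
  rw [prefixMean, norm_mul, norm_inv, Complex.norm_natCast]
  rcases Nat.eq_zero_or_pos N with rfl | hN
  · simpa using hC
  · have hN' : (0 : ℝ) < N := by exact_mod_cast hN
    rw [inv_mul_le_iff₀ hN']
    calc _ ≤ ∑ n ∈ Finset.Icc 1 N, C := norm_sum_le_of_le _ fun n _ => hz n
      _ = _ := by simp

theorem MeanZero.tendsto_prefixMean {z : ℕ → ℂ} (hz : MeanZero z) {C : ℝ} (hC : ∀ n, ‖z n‖ ≤ C) :
    Tendsto (prefixMean z) atTop (𝓝 0) := by
  have h := hz.add (meanZero_shift_sub hC)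
  simp only [add_sub_cancel] at h
  refine h.congr fun N => ?_
  rw [prefixMean, Finset.range_eq_Ico, Finset.sum_Ico_add' (fun n => z n) 0 N 1, zero_add,
    Complex.real_smul]
  push_cast
  rfl

theorem tendsto_prefixMean_zero {z : ℕ → ℂ} (hz : Tendsto z atTop (𝓝 0)) :
    Tendsto (prefixMean z) atTop (𝓝 0) := by
  refine (meanZero_of_tendsto ((tendsto_add_atTop_iff_nat 1).2 hz)).congr fun N => ?_
  rw [prefixMean, Finset.range_eq_Ico, Finset.sum_Ico_add' (fun n => z n) 0 N 1, zero_add,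
    Complex.real_smul]
  push_cast
  rfl

theorem tendsto_prefixMean_of_sub {M : ℕ → ℕ} (hM : Tendsto M atTop atTop) {z w : ℕ → ℂ} {l : ℂ}
    (hz : Tendsto (fun k => prefixMean z (M k)) atTop (𝓝 l))
    (h : Tendsto (fun n => w n - z n) atTop (𝓝 0)) :
    Tendsto (fun k => prefixMean w (M k)) atTop (𝓝 l) := by
  have := hz.add ((tendsto_prefixMean_zero h).comp hM)
  rw [add_zero] at this
  refine this.congr fun k => ?_
  rw [Function.comp_apply, ← prefixMean_add]
  simp

theorem integral_empiricalMeasure {X E : Type*} [MeasurableSpace X] [NormedAddCommGroup E]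
    [NormedSpace ℝ E] [CompleteSpace E] (x : ℕ → X) (N : ℕ) {f : X → E}
    (hf : StronglyMeasurable f) :
    ∫ y, f y ∂(empiricalMeasure x N) = (N : ℝ)⁻¹ • ∑ n ∈ Finset.Icc 1 N, f (x n) := by
  have hint : ∀ n ∈ Finset.Icc 1 N, Integrable f (Measure.dirac (x n)) := fun n _ =>
    integrable_dirac' hf (by simp)
  rw [empiricalMeasure, integral_smul_measure, integral_finsetSum_measure hint]
  simp only [integral_dirac' _ _ hf, ENNReal.toReal_inv, ENNReal.toReal_natCast]

/-- Passes from real test functions to complex ones, which characters require, by splitting into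
real and imaginary parts. -/
theorem isWeakStarLimit_empiricalMeasure_iff {X : Type*} [TopologicalSpace X] [CompactSpace X]
    [MeasurableSpace X] [BorelSpace X] {x : ℕ → X} {M : ℕ → ℕ} {μ : Measure X}
    [IsFiniteMeasure μ] :
    IsWeakStarLimit (fun k => empiricalMeasure x (M k)) μ ↔
      ∀ f : C(X, ℂ), Tendsto (fun k => prefixMean (fun n => f (x n)) (M k)) atTop
        (𝓝 (∫ y, f y ∂μ)) := by
  have hmean : ∀ (f : C(X, ℝ)) (N : ℕ), ((∫ y, f y ∂(empiricalMeasure x N) : ℝ) : ℂ) =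
      prefixMean (fun n => (f (x n) : ℂ)) N := fun f N => by
    rw [integral_empiricalMeasure x N f.continuous.measurable.stronglyMeasurable, prefixMean,
      smul_eq_mul]
    push_cast
    rfl
  constructor
  · intro h f
    have hre := (Complex.continuous_ofReal.tendsto _).comp
      (h ⟨fun y => (f y).re, by fun_prop⟩)
    have him := (Complex.continuous_ofReal.tendsto _).comp
      (h ⟨fun y => (f y).im, by fun_prop⟩)
    have hint : Integrable f μ :=
      f.continuous.integrable_of_hasCompactSupport (HasCompactSupport.of_compactSpace f)
    have hsum := hre.add (him.mul_const Complex.I)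
    have e : ((∫ y, (f y).re ∂μ : ℝ) : ℂ) + ((∫ y, (f y).im ∂μ : ℝ) : ℂ) * Complex.I =
        ∫ y, f y ∂μ := integral_re_add_im hint
    simp only [ContinuousMap.coe_mk] at hsum
    rw [e] at hsum
    refine hsum.congr fun k => ?_
    simp only [Function.comp_apply]
    have e1 := hmean ⟨fun y => (f y).re, by fun_prop⟩ (M k)
    have e2 := hmean ⟨fun y => (f y).im, by fun_prop⟩ (M k)
    simp only [ContinuousMap.coe_mk] at e1 e2
    rw [e1, e2, mul_comm, ← prefixMean_const_mul, ← prefixMean_add]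
    congr 1
    ext n
    rw [mul_comm]
    exact Complex.re_add_im _
  · intro h f
    have h1 := h ⟨fun y => (f y : ℂ), by fun_prop⟩
    simp only [ContinuousMap.coe_mk, integral_complex_ofReal, ← hmean] at h1
    exact (Complex.continuous_re.tendsto _).comp h1

/-- Continuous functions of asymptotically equal sequences are asymptotically equal. -/
theorem tendsto_apply_sub_apply {X ι : Type*} [UniformSpace X] [CompactSpace X] (f : C(X, ℂ))
    {l : Filter ι} {x y : ι → X} (h : Tendsto (fun n => (x n, y n)) l (uniformity X)) :
    Tendsto (fun n => f (y n) - f (x n)) l (𝓝 0) := by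
  have := Tendsto.comp (CompactSpace.uniformContinuous_of_continuous f.continuous) h
  rw [uniformity_eq_comap_nhds_zero, tendsto_comap_iff] at this
  exact this

/-- Two finite measures on a compact space are equal if they assign the same integrals to
continuous functions. -/
theorem measure_eq_of_forall_integral_eq {X : Type*} [TopologicalSpace X] [MeasurableSpace X]
    [BorelSpace X] [HasOuterApproxClosed X] {μ ν : Measure X} [IsFiniteMeasure μ]
    [IsFiniteMeasure ν] (h : ∀ f : C(X, ℝ), ∫ x, f x ∂μ = ∫ x, f x ∂ν) : μ = ν :=
  ext_of_forall_integral_eq_of_IsFiniteMeasure fun f => h f.toContinuousMap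

open UnitAddTorus in
/-- Weyl's criterion: convergence of the means of all characters of a torus implies convergence of
the means of all continuous functions. -/
theorem tendsto_prefixMean_of_mFourier {ι : Type*} [Fintype ι] {y : ℕ → UnitAddTorus ι}
    {M : ℕ → ℕ} {ν : Measure (UnitAddTorus ι)} [IsProbabilityMeasure ν]
    (h : ∀ k : ι → ℤ, Tendsto (fun j => prefixMean (fun n => mFourier k (y n)) (M j)) atTop
      (𝓝 (∫ x, mFourier k x ∂ν))) (f : C(UnitAddTorus ι, ℂ)) :
    Tendsto (fun j => prefixMean (fun n => f (y n)) (M j)) atTop (𝓝 (∫ x, f x ∂ν)) := by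
  have hint : ∀ f : C(UnitAddTorus ι, ℂ), Integrable f ν := fun f =>
    f.continuous.integrable_of_hasCompactSupport (HasCompactSupport.of_compactSpace f)
  have hspan : ∀ g ∈ Submodule.span ℂ (Set.range (mFourier (d := ι))),
      Tendsto (fun j => prefixMean (fun n => g (y n)) (M j)) atTop (𝓝 (∫ x, g x ∂ν)) := by
    intro g hg
    induction hg using Submodule.span_induction with
    | mem g hg =>
      obtain ⟨k, rfl⟩ := hg
      exact h k
    | zero => simp [prefixMean]
    | add g₁ g₂ _ _ h₁ h₂ =>
      simp only [ContinuousMap.add_apply, prefixMean_add]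
      rw [integral_add (hint g₁) (hint g₂)]
      exact h₁.add h₂
    | smul c g _ h₁ =>
      simp only [ContinuousMap.smul_apply, smul_eq_mul, prefixMean_const_mul]
      rw [integral_const_mul]
      exact h₁.const_mul c
  rw [Metric.tendsto_nhds]
  intro ε hε
  have hmem : f ∈ closure (Submodule.span ℂ (Set.range (mFourier (d := ι))) :
      Set C(UnitAddTorus ι, ℂ)) := by
    rw [← Submodule.topologicalClosure_coe, span_mFourier_closure_eq_top]
    trivial
  obtain ⟨g, hg, hfg⟩ := Metric.mem_closure_iff.1 hmem (ε / 3) (by positivity)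
  have hpt : ∀ x, ‖f x - g x‖ ≤ ε / 3 := fun x => by
    rw [← dist_eq_norm]
    exact (ContinuousMap.dist_apply_le_dist x).trans hfg.le
  filter_upwards [Metric.tendsto_nhds.1 (hspan g hg) (ε / 3) (by positivity)] with j hj
  have h1 : dist (prefixMean (fun n => f (y n)) (M j)) (prefixMean (fun n => g (y n)) (M j)) ≤
      ε / 3 := by
    have e : prefixMean (fun n => f (y n)) (M j) =
        prefixMean (fun n => f (y n) - g (y n)) (M j) + prefixMean (fun n => g (y n)) (M j) := by
      rw [← prefixMean_add]
      simp
    rw [dist_eq_norm, e, add_sub_cancel_right]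
    exact norm_prefixMean_le (by positivity) (fun n => hpt _) _
  have h2 : dist (∫ x, f x ∂ν) (∫ x, g x ∂ν) ≤ ε / 3 := by
    rw [dist_eq_norm, ← integral_sub (hint f) (hint g)]
    simpa using norm_integral_le_of_norm_le_const (μ := ν) (.of_forall hpt)
  have h3 := dist_triangle4_right (prefixMean (fun n => f (y n)) (M j)) (∫ x, f x ∂ν)
    (prefixMean (fun n => g (y n)) (M j)) (∫ x, g x ∂ν)
  linarith

/-! ### Fourier coefficients of the limit measure. -/

theorem fourier_coe_eq_fourierChar (k : ℤ) (x : ℝ) :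
    fourier k (x : UnitAddCircle) = (𝐞 (k * x) : ℂ) := by
  rw [fourier_coe_apply, Real.fourierChar_apply]
  congr 1
  push_cast
  ring

/-- Translation by 1/(2k) preserves Haar measure and changes the sign of the character. -/
theorem integral_fourier_haarAddCircle {k : ℤ} (hk : k ≠ 0) :
    ∫ x, fourier k x ∂(AddCircle.haarAddCircle (T := (1 : ℝ))) = 0 := by
  have h := integral_add_right_eq_self (μ := AddCircle.haarAddCircle (T := (1 : ℝ)))
    (fun x => (fourier k x : ℂ)) ((((1 : ℝ) / 2 / k : ℝ)) : AddCircle (1 : ℝ))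
  have e : ∀ x : AddCircle (1 : ℝ),
      (fourier k (x + (((1 : ℝ) / 2 / k : ℝ) : AddCircle (1 : ℝ))) : ℂ) = -fourier k x := fun x =>
    fourier_add_half_inv_index hk one_pos x
  simp only [e, integral_neg] at h
  exact self_eq_neg.1 h.symm

instance instIsProbabilityMeasureUnipotent (d : ℕ) (lam : Measure UnitAddCircle)
    [IsProbabilityMeasure lam] : IsProbabilityMeasure (unipotentMeasure d lam) := by
  have : ∀ i : Fin (d + 1), IsProbabilityMeasure
      ((fun i => if i = 0 then lam else AddCircle.haarAddCircle :
        Fin (d + 1) → Measure UnitAddCircle) i) := fun i => by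
    dsimp only
    split_ifs <;> infer_instance
  unfold unipotentMeasure
  infer_instance

theorem integral_mFourier_unipotentMeasure (d : ℕ) (lam : Measure UnitAddCircle)
    [IsProbabilityMeasure lam] (k : Fin (d + 1) → ℤ) :
    ∫ x, UnitAddTorus.mFourier k x ∂(unipotentMeasure d lam) =
      (∫ x, fourier (k 0) x ∂lam) *
        ∏ i : Fin d, ∫ x, fourier (k i.succ) x ∂(AddCircle.haarAddCircle (T := (1 : ℝ))) := by
  have : ∀ i : Fin (d + 1), IsProbabilityMeasure
      ((fun i => if i = 0 then lam else AddCircle.haarAddCircle :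
        Fin (d + 1) → Measure UnitAddCircle) i) := fun i => by
    dsimp only
    split_ifs <;> infer_instance
  unfold unipotentMeasure
  have h := integral_fintype_prod_eq_prod (𝕜 := ℂ)
    (fun (i : Fin (d + 1)) (x : UnitAddCircle) => (fourier (k i) x : ℂ))
    (μ := fun i => if i = 0 then lam else AddCircle.haarAddCircle)
  rw [Fin.prod_univ_succ] at h
  simp only [Fin.succ_ne_zero, if_true, if_false] at h
  exact h

/-! ### The unipotent map and its coding in the shift space. -/

/-- The nilpotent part of `unipotentMap d`. -/
def nilpotentShift (d : ℕ) :
    (Fin (d + 1) → UnitAddCircle) →L[ℤ] (Fin (d + 1) → UnitAddCircle) where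
  toFun y := Fin.cons 0 (fun i : Fin d => y i.castSucc)
  map_add' y z := by
    ext i
    refine Fin.cases ?_ (fun i => ?_) i <;> simp
  map_smul' c y := by
    ext i
    refine Fin.cases ?_ (fun i => ?_) i <;> simp
  cont := by
    refine continuous_pi fun i => ?_
    refine Fin.cases ?_ (fun i => ?_) i
    · simpa using continuous_const
    · simpa using continuous_apply _

/-- Each application moves the coordinates up one place and fills in 0. Nilpotency within the ring
of continuous endomorphisms makes every integer power of S_d, negative ones included, continuous and
additive. -/
theorem isNilpotent_nilpotentShift (d : ℕ) : IsNilpotent (nilpotentShift d) := by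
  have h : ∀ (j : ℕ) (y : Fin (d + 1) → UnitAddCircle) (i : Fin (d + 1)), (i : ℕ) < j →
      (nilpotentShift d ^ j) y i = 0 := by
    intro j
    induction j with
    | zero => intro y i hi; exact absurd hi (Nat.not_lt_zero _)
    | succ j ih =>
      intro y i
      rw [pow_succ']
      refine Fin.cases (fun _ => rfl) (fun i hi => ?_) i
      exact ih y i.castSucc (by simpa using hi)
  exact ⟨d + 1, ContinuousLinearMap.ext fun y => funext fun i => h _ y i i.2⟩

theorem one_add_nilpotentShift_apply (d : ℕ) (y : Fin (d + 1) → UnitAddCircle) :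
    (1 + nilpotentShift d) y = unipotentMap d y := by
  ext i
  refine Fin.cases ?_ (fun i => ?_) i
  · exact add_zero _
  · rfl

/-- `unipotentMap d` as an invertible continuous endomorphism of the torus. -/
noncomputable def unipotentUnit (d : ℕ) :
    ((Fin (d + 1) → UnitAddCircle) →L[ℤ] (Fin (d + 1) → UnitAddCircle))ˣ :=
  (isNilpotent_nilpotentShift d).isUnit_one_add.unit

/-- The integer powers of `unipotentMap d`. -/
noncomputable def unipotentPow (d : ℕ) (h : ℤ) :
    (Fin (d + 1) → UnitAddCircle) →L[ℤ] (Fin (d + 1) → UnitAddCircle) :=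
  ((unipotentUnit d ^ h :
    ((Fin (d + 1) → UnitAddCircle) →L[ℤ] (Fin (d + 1) → UnitAddCircle))ˣ))

theorem unipotentPow_zero (d : ℕ) (y : Fin (d + 1) → UnitAddCircle) :
    unipotentPow d 0 y = y := by
  simp [unipotentPow]

theorem unipotentPow_one (d : ℕ) (y : Fin (d + 1) → UnitAddCircle) :
    unipotentPow d 1 y = unipotentMap d y := by
  rw [unipotentPow, zpow_one]
  exact one_add_nilpotentShift_apply d y

theorem unipotentPow_add (d : ℕ) (h k : ℤ) (y : Fin (d + 1) → UnitAddCircle) :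
    unipotentPow d (h + k) y = unipotentPow d h (unipotentPow d k y) := by
  rw [unipotentPow, zpow_add, Units.val_mul]
  rfl

theorem unipotentPow_add_one (d : ℕ) (h : ℤ) (y : Fin (d + 1) → UnitAddCircle) :
    unipotentPow d (h + 1) y = unipotentMap d (unipotentPow d h y) := by
  rw [add_comm h 1, unipotentPow_add, unipotentPow_one]

theorem continuous_unipotentMap (d : ℕ) : Continuous (unipotentMap d) := by
  have : unipotentMap d = unipotentPow d 1 := funext fun y => (unipotentPow_one d y).symm
  rw [this]
  exact (unipotentPow d 1).continuous

/-- The sequence of last coordinates along the orbit of `y`, as a point of `Circle ^ ℤ`. -/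
noncomputable def orbitCoding (d : ℕ) (y : Fin (d + 1) → UnitAddCircle) : ℤ → Circle :=
  fun h => AddCircle.toCircle (unipotentPow d h y (Fin.last d))

theorem continuous_orbitCoding (d : ℕ) : Continuous (orbitCoding d) :=
  continuous_pi fun h => AddCircle.continuous_toCircle.comp
    ((continuous_apply _).comp (unipotentPow d h).continuous)

theorem orbitCoding_unipotentMap (d : ℕ) (y : Fin (d + 1) → UnitAddCircle) :
    orbitCoding d (unipotentMap d y) = shiftMap Circle (orbitCoding d y) := by
  ext h
  rw [shiftMap, orbitCoding, orbitCoding, unipotentPow_add, unipotentPow_one]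

/-- Along the orbit, coordinate i is the difference of consecutive values of coordinate i + 1, so
the last coordinate determines all others, by descending induction. -/
theorem injective_orbitCoding (d : ℕ) : Function.Injective (orbitCoding d) := by
  intro y z hyz
  have h : ∀ (i : Fin (d + 1)) (h : ℤ), unipotentPow d h y i = unipotentPow d h z i := by
    intro i
    induction i using Fin.reverseInduction with
    | last => exact fun h => AddCircle.injective_toCircle one_ne_zero (congrFun hyz h)
    | cast i ih =>
      intro h
      have h1 := ih (h + 1)
      rw [unipotentPow_add_one, unipotentPow_add_one] at h1
      have h2 : unipotentPow d h y i.succ + unipotentPow d h y i.castSucc =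
        unipotentPow d h z i.succ + unipotentPow d h z i.castSucc := h1
      rw [ih h] at h2
      exact add_left_cancel h2
  ext i
  simpa [unipotentPow_zero] using h i 0

theorem measurableEmbedding_orbitCoding (d : ℕ) : MeasurableEmbedding (orbitCoding d) :=
  ((continuous_orbitCoding d).isClosedEmbedding (injective_orbitCoding d)).measurableEmbedding

theorem shiftMap_iterate_apply {Y : Type*} (b : ℤ → Y) (m : ℕ) (h : ℤ) :
    (shiftMap Y)^[m] b h = b (m + h) := by
  induction m generalizing h with
  | zero => simp
  | succ m ih =>
    rw [Function.iterate_succ_apply', shiftMap, ih]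
    congr 1
    push_cast
    ring

theorem isSystem_shiftMap {Y : Type*} [MeasurableSpace Y] {μ : Measure (ℤ → Y)}
    [IsProbabilityMeasure μ] (h : μ.map (shiftMap Y) = μ) : IsSystem μ (shiftMap Y) where
  isProbabilityMeasure := inferInstance
  measurePreserving := ⟨measurable_pi_lambda _ fun n => measurable_pi_apply _, h⟩
  exists_inverse := ⟨fun x n => x (n - 1), measurable_pi_lambda _ fun n => measurable_pi_apply _,
    fun x => by ext n; simp [shiftMap], fun x => by ext n; simp [shiftMap]⟩

theorem isSystem_unipotentMap {d : ℕ} {ν : Measure (Fin (d + 1) → UnitAddCircle)}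
    [IsProbabilityMeasure ν] (h : ν.map (unipotentMap d) = ν) : IsSystem ν (unipotentMap d) where
  isProbabilityMeasure := inferInstance
  measurePreserving := ⟨(continuous_unipotentMap d).measurable, h⟩
  exists_inverse := by
    refine ⟨unipotentPow d (-1), (unipotentPow d (-1)).continuous.measurable, fun y => ?_,
      fun y => ?_⟩
    · rw [← unipotentPow_one, ← unipotentPow_add]
      exact unipotentPow_zero d y
    · rw [← unipotentPow_one, ← unipotentPow_add]
      exact unipotentPow_zero d y

theorem areIsomorphicSystems_map_orbitCoding {d : ℕ}
    {ν : Measure (Fin (d + 1) → UnitAddCircle)} [IsProbabilityMeasure ν]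
    (h : ν.map (unipotentMap d) = ν) :
    AreIsomorphicSystems (ν.map (orbitCoding d)) (shiftMap Circle) ν (unipotentMap d) := by
  have hemb := measurableEmbedding_orbitCoding d
  have hprob : IsProbabilityMeasure (ν.map (orbitCoding d)) :=
    Measure.isProbabilityMeasure_map hemb.measurable.aemeasurable
  have hshift : Measurable (shiftMap Circle) :=
    measurable_pi_lambda _ fun n => measurable_pi_apply _
  refine ⟨isSystem_shiftMap ?_, isSystem_unipotentMap h, ?_⟩
  · have e : shiftMap Circle ∘ orbitCoding d = orbitCoding d ∘ unipotentMap d :=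
      funext fun y => (orbitCoding_unipotentMap d y).symm
    rw [Measure.map_map hshift hemb.measurable, e,
      ← Measure.map_map hemb.measurable (continuous_unipotentMap d).measurable, h]
  -- A measurable left inverse of the embedding, given a default value off its range, which is a
  -- null set for the image measure.
  · obtain ⟨φ, hφ, hφ'⟩ := hemb.exists_measurable_extend measurable_id fun _ => ⟨0⟩
    have hφ'' : ∀ y, φ (orbitCoding d y) = y := fun y => congrFun hφ' y
    refine ⟨φ, orbitCoding d, ⟨hφ, ?_⟩, ⟨hemb.measurable, rfl⟩, ?_, .of_forall hφ'', ?_⟩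
    · rw [Measure.map_map hφ hemb.measurable, hφ', Measure.map_id]
    · rw [hemb.ae_map_iff]
      exact .of_forall fun y => by rw [hφ'']
    · rw [hemb.ae_map_iff]
      exact .of_forall fun y => by rw [← orbitCoding_unipotentMap, hφ'', hφ'']

/-! ### The difference points: distribution and dynamics. -/

/-- The point of the torus whose coordinates are the iterated differences of `a` at `t`. -/
def differencePoint (d : ℕ) (a : ℝ → ℝ) (t : ℝ) : Fin (d + 1) → UnitAddCircle :=
  fun i => (((fwdDiff 1)^[d - i] a t : ℝ) : UnitAddCircle)

theorem mFourier_differencePoint (d : ℕ) (a : ℝ → ℝ) (k : Fin (d + 1) → ℤ) (t : ℝ) :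
    UnitAddTorus.mFourier k (differencePoint d a t) =
      (𝐞 (∑ i : Fin (d + 1), k i * (fwdDiff 1)^[d - i] a t) : ℂ) := by
  have : UnitAddTorus.mFourier k (differencePoint d a t) =
      ∏ i : Fin (d + 1), fourier (k i) (differencePoint d a t i) := rfl
  rw [this]
  simp only [differencePoint, fourier_coe_eq_fourierChar, Real.fourierChar_apply]
  rw [← Complex.exp_sum, ← Finset.sum_mul, ← Complex.ofReal_sum, ← Finset.mul_sum]

/-- A character with some k_i ≠ 0, i ≥ 1, has integral 0 because of a Haar factor, and its means
tend to 0 by the exponential sum bound. Any other character sees only coordinate 0, where Δ^d a may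
be replaced by a^{(d)}. -/
theorem IsHardyField.tendsto_prefixMean_differencePoint {H : Subring (Germ (atTop : Filter ℝ) ℝ)}
    (hH : IsHardyField H) {a : ℝ → ℝ} (ha : (a : Germ (atTop : Filter ℝ) ℝ) ∈ H) (d : ℕ)
    (h1 : HasNonresonantLimit (iteratedDeriv d a))
    (h2 : ∀ m, d < m → Tendsto (iteratedDeriv m a) atTop (𝓝 0))
    {M : ℕ → ℕ} (hM : Tendsto M atTop atTop)
    {lam : Measure UnitAddCircle} [IsProbabilityMeasure lam]
    (hlam : IsWeakStarLimit
      (fun k => empiricalMeasure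
        (fun n : ℕ => ((iteratedDeriv d a (n : ℝ) : ℝ) : UnitAddCircle)) (M k)) lam)
    (f : C(Fin (d + 1) → UnitAddCircle, ℂ)) :
    Tendsto (fun j => prefixMean (fun n => f (differencePoint d a n)) (M j)) atTop
      (𝓝 (∫ x, f x ∂(unipotentMeasure d lam))) := by
  refine tendsto_prefixMean_of_mFourier (fun k => ?_) f
  rw [integral_mFourier_unipotentMeasure]
  simp only [mFourier_differencePoint]
  by_cases hk : ∃ i, i ≠ 0 ∧ k i ≠ 0
  · have h0 : ∏ i : Fin d,
        ∫ x, fourier (k i.succ) x ∂(AddCircle.haarAddCircle (T := (1 : ℝ))) = 0 := by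
      obtain ⟨i, hi, hki⟩ := hk
      obtain ⟨i, rfl⟩ := Fin.exists_succ_eq.2 hi
      exact Finset.prod_eq_zero (Finset.mem_univ i) (integral_fourier_haarAddCircle hki)
    rw [h0, mul_zero]
    exact ((hH.meanZero_fourierChar_sum_fwdDiff ha d h1 h2 k hk).tendsto_prefixMean
      (fun n => (Circle.norm_coe _).le)).comp hM
  · push Not at hk
    have hk' : ∀ i : Fin d, k i.succ = 0 := fun i => hk _ (Fin.succ_ne_zero i)
    simp only [Fin.sum_univ_succ, hk', fourier_zero, integral_const, probReal_univ, one_smul,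
      Finset.prod_const_one, mul_one, Int.cast_zero, zero_mul, Finset.sum_const_zero, add_zero]
    refine tendsto_prefixMean_of_sub hM
      (isWeakStarLimit_empiricalMeasure_iff.1 hlam (fourier (k 0))) ?_
    simp only [fourier_coe_eq_fourierChar]
    have h3 := ((hH.tendsto_fwdDiff_iter_sub_iteratedDeriv d ha (h2 _ (Nat.lt_succ_self d))).comp
      tendsto_natCast_atTop_atTop).abs.const_mul (2 * π * |(k 0 : ℝ)|)
    rw [abs_zero, mul_zero] at h3
    refine squeeze_zero_norm (fun n => (norm_fourierChar_sub_le _ _).trans (le_of_eq ?_)) h3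
    rw [← mul_sub, abs_mul, ← mul_assoc]
    rfl

/-- Only coordinate 0 carries an error, namely Δ^{d+1} a(t); the others satisfy Δ^j a(t+1) = Δ^j
a(t) + Δ^{j+1} a(t). -/
theorem IsHardyField.tendsto_differencePoint_sub_unipotentMap
    {H : Subring (Germ (atTop : Filter ℝ) ℝ)}
    (hH : IsHardyField H) {a : ℝ → ℝ} (ha : (a : Germ (atTop : Filter ℝ) ℝ) ∈ H) (d : ℕ)
    (h2 : Tendsto (iteratedDeriv (d + 1) a) atTop (𝓝 0)) :
    Tendsto (fun t => differencePoint d a (t + 1) - unipotentMap d (differencePoint d a t)) atTop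
      (𝓝 0) := by
  rw [tendsto_pi_nhds]
  refine Fin.cases ?_ fun i => ?_
  · have h3 : Tendsto ((fwdDiff 1)^[d + 1] a) atTop (𝓝 0) := by
      simpa using hH.tendsto_iteratedDeriv_fwdDiff_iter (d + 1) ha 0 (by simpa using h2)
    have h4 := ((AddCircle.continuous_mk' (1 : ℝ)).tendsto 0).comp h3
    refine h4.congr fun t => ?_
    simp only [Function.comp_apply, Function.iterate_succ_apply', fwdDiff]
    rfl
  · refine tendsto_const_nhds.congr fun t => ?_
    have e : d - (i.castSucc : ℕ) = (d - (i.succ : ℕ)) + 1 := by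
      have := i.2
      simp only [Fin.val_castSucc, Fin.val_succ]
      omega
    have e2 : (fwdDiff 1)^[d - (i.castSucc : ℕ)] a t =
        (fwdDiff 1)^[d - (i.succ : ℕ)] a (t + 1) - (fwdDiff 1)^[d - (i.succ : ℕ)] a t := by
      rw [e, Function.iterate_succ_apply']
      rfl
    have e3 : unipotentMap d (differencePoint d a t) i.succ =
        differencePoint d a t i.succ + differencePoint d a t i.castSucc := rfl
    rw [Pi.sub_apply, e3]
    simp only [differencePoint, e2, AddCircle.coe_sub, Pi.zero_apply]
    abel

/-- Induction on h in both directions: the maps S_d and S_d^{-1} are additive and continuous, so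
they carry a vanishing error to a vanishing error. -/
theorem IsHardyField.tendsto_differencePoint_sub_unipotentPow
    {H : Subring (Germ (atTop : Filter ℝ) ℝ)}
    (hH : IsHardyField H) {a : ℝ → ℝ} (ha : (a : Germ (atTop : Filter ℝ) ℝ) ∈ H) (d : ℕ)
    (h2 : Tendsto (iteratedDeriv (d + 1) a) atTop (𝓝 0)) (h : ℤ) :
    Tendsto (fun t => differencePoint d a (t + h) - unipotentPow d h (differencePoint d a t))
      atTop (𝓝 0) := by
  have hstep := hH.tendsto_differencePoint_sub_unipotentMap ha d h2
  induction h using Int.induction_on with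
  | zero => simp [unipotentPow_zero]
  | succ h ih =>
    have h3 := hstep.comp (tendsto_atTop_add_const_right atTop ((h : ℤ) : ℝ) tendsto_id)
    have h4 := ((unipotentPow d 1).continuous.tendsto 0).comp ih
    have h5 := h3.add h4
    rw [map_zero, add_zero] at h5
    refine h5.congr fun t => ?_
    simp only [Function.comp_apply, id, map_sub, unipotentPow_add_one, unipotentPow_one]
    push_cast
    rw [add_assoc t]
    abel
  | pred h ih =>
    have h3 := hstep.comp
      (tendsto_atTop_add_const_right atTop ((-(h : ℤ) - 1 : ℤ) : ℝ) tendsto_id)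
    have h4 := ih.sub h3
    rw [sub_zero] at h4
    have h5 := ((unipotentPow d (-1)).continuous.tendsto 0).comp h4
    rw [map_zero] at h5
    refine h5.congr fun t => ?_
    simp only [Function.comp_apply, id]
    have e1 : t + ((-(h : ℤ) - 1 : ℤ) : ℝ) + 1 = t + ((-(h : ℤ) : ℤ) : ℝ) := by
      push_cast; ring
    have e2 : ∀ y, unipotentPow d (-1) (unipotentMap d y) = y := fun y => by
      rw [← unipotentPow_one, ← unipotentPow_add]
      exact unipotentPow_zero d y
    rw [e1, sub_sub_sub_cancel_left, map_sub, e2, ← unipotentPow_add]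
    rw [neg_add_eq_sub, sub_eq_neg_add (-(h : ℤ)) 1, neg_add_eq_sub]

/-- Means of continuous functions along the shifts of `b` are asymptotically means along the
orbit codings of the difference points. -/
theorem IsHardyField.tendsto_prefixMean_shift {H : Subring (Germ (atTop : Filter ℝ) ℝ)}
    (hH : IsHardyField H) {a : ℝ → ℝ} (ha : (a : Germ (atTop : Filter ℝ) ℝ) ∈ H) (d : ℕ)
    (h2 : Tendsto (iteratedDeriv (d + 1) a) atTop (𝓝 0))
    {M : ℕ → ℕ} (hM : Tendsto M atTop atTop)
    {ν : Measure (Fin (d + 1) → UnitAddCircle)}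
    (hν : ∀ f : C(Fin (d + 1) → UnitAddCircle, ℂ),
      Tendsto (fun j => prefixMean (fun n => f (differencePoint d a n)) (M j)) atTop
        (𝓝 (∫ x, f x ∂ν)))
    {b : ℤ → Circle} (hb : ∀ n : ℕ, 0 < n → b (n : ℤ) = Circle.exp (2 * π * a (n : ℝ)))
    (f : C(ℤ → Circle, ℂ)) :
    Tendsto (fun j => prefixMean (fun m => f ((shiftMap Circle)^[m] b)) (M j)) atTop
      (𝓝 (∫ x, f x ∂(ν.map (orbitCoding d)))) := by
  have hb' : ∀ n : ℤ, 0 < n → b n = AddCircle.toCircle (differencePoint d a n (Fin.last d)) := by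
    intro n hn
    lift n to ℕ using hn.le
    rw [hb n (by exact_mod_cast hn)]
    simp [differencePoint, AddCircle.toCircle_apply_mk]
  have hf := hν (f.comp ⟨orbitCoding d, continuous_orbitCoding d⟩)
  have hint : ∫ x, f x ∂(ν.map (orbitCoding d)) = ∫ y, f (orbitCoding d y) ∂ν :=
    (measurableEmbedding_orbitCoding d).integral_map _
  rw [hint]
  refine tendsto_prefixMean_of_sub hM hf ?_
  refine tendsto_apply_sub_apply f ?_
  -- Closeness in the product is closeness in each coordinate h, so h may be fixed and no uniformity
  -- in h is needed.
  rw [Pi.uniformity, tendsto_iInf]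
  intro h
  rw [tendsto_comap_iff]
  have h3 := (hH.tendsto_differencePoint_sub_unipotentPow ha d h2 h).comp
    tendsto_natCast_atTop_atTop
  have h4 : Tendsto (fun n : ℕ => ((unipotentPow d h (differencePoint d a n)) (Fin.last d),
      differencePoint d a (n + h) (Fin.last d))) atTop (uniformity UnitAddCircle) := by
    rw [uniformity_eq_comap_nhds_zero, tendsto_comap_iff]
    exact tendsto_pi_nhds.1 h3 (Fin.last d)
  refine (Tendsto.comp (CompactSpace.uniformContinuous_of_continuous
    (AddCircle.continuous_toCircle (T := 1))) h4).congr' ?_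
  -- For such n the index n + h is positive, so the arbitrary values of b at nonpositive integers do
  -- not matter.
  filter_upwards [eventually_gt_atTop (-h).toNat] with n hn
  simp only [Function.comp_apply, shiftMap_iterate_apply]
  rw [hb' (n + h) (by omega)]
  simp only [orbitCoding, ContinuousMap.coe_mk]
  push_cast
  rfl

/-- The values f(S_d y(n)) and f(y(n+1)) are asymptotically equal, and the means of f(y(n+1)) −
f(y(n)) telescope to 0. -/
theorem IsHardyField.map_unipotentMap_eq {H : Subring (Germ (atTop : Filter ℝ) ℝ)}
    (hH : IsHardyField H) {a : ℝ → ℝ} (ha : (a : Germ (atTop : Filter ℝ) ℝ) ∈ H) (d : ℕ)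
    (h2 : Tendsto (iteratedDeriv (d + 1) a) atTop (𝓝 0))
    {M : ℕ → ℕ} (hM : Tendsto M atTop atTop)
    {ν : Measure (Fin (d + 1) → UnitAddCircle)} [IsProbabilityMeasure ν]
    (hν : ∀ f : C(Fin (d + 1) → UnitAddCircle, ℂ),
      Tendsto (fun j => prefixMean (fun n => f (differencePoint d a n)) (M j)) atTop
        (𝓝 (∫ x, f x ∂ν))) :
    ν.map (unipotentMap d) = ν := by
  have hcont := continuous_unipotentMap d
  have : IsProbabilityMeasure (ν.map (unipotentMap d)) :=
    Measure.isProbabilityMeasure_map hcont.measurable.aemeasurable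
  refine measure_eq_of_forall_integral_eq fun f => ?_
  rw [integral_map hcont.measurable.aemeasurable
    f.continuous.measurable.stronglyMeasurable.aestronglyMeasurable]
  set g : C(Fin (d + 1) → UnitAddCircle, ℂ) := ⟨fun y => (f y : ℂ), by fun_prop⟩ with hg
  have h1 := hν (g.comp ⟨unipotentMap d, hcont⟩)
  have h3 : Tendsto (fun n : ℕ => g (differencePoint d a ((n + 1 : ℕ) : ℝ)) -
      g (unipotentMap d (differencePoint d a n))) atTop (𝓝 0) := by
    refine tendsto_apply_sub_apply g ?_
    rw [uniformity_eq_comap_nhds_zero, tendsto_comap_iff]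
    refine ((hH.tendsto_differencePoint_sub_unipotentMap ha d h2).comp
      tendsto_natCast_atTop_atTop).congr fun n => ?_
    simp
  have h4 := tendsto_prefixMean_of_sub hM h1 h3
  have hbd : ∀ n : ℕ, ‖g (differencePoint d a n)‖ ≤ ‖g‖ := fun n => g.norm_coe_le_norm _
  have hbd2 : ∀ n : ℕ, ‖g (differencePoint d a ((n + 1 : ℕ) : ℝ)) -
      g (differencePoint d a n)‖ ≤ 2 * ‖g‖ := fun n => by
    refine (norm_sub_le _ _).trans ?_
    linarith [hbd n, hbd (n + 1)]
  have h5 := (hν g).add (((meanZero_shift_sub hbd).tendsto_prefixMean hbd2).comp hM)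
  simp only [Function.comp_apply, ← prefixMean_add, add_sub_cancel, add_zero] at h5
  have h6 := tendsto_nhds_unique h4 h5
  simp only [hg, ContinuousMap.comp_apply, ContinuousMap.coe_mk, integral_complex_ofReal] at h6
  exact_mod_cast h6

theorem admitsCorrelations_of_tendsto {Y : Type*} [TopologicalSpace Y] {b : ℤ → Y} {M : ℕ → ℕ}
    (h : ∀ f : C(ℤ → Y, ℂ), ∃ L : ℂ,
      Tendsto (fun j => prefixMean (fun m => f ((shiftMap Y)^[m] b)) (M j)) atTop (𝓝 L)) :
    AdmitsCorrelations b M := by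
  intro s n f
  obtain ⟨L, hL⟩ := h ⟨fun x => ∏ j, f j (x (n j)), by fun_prop⟩
  refine ⟨L, hL.congr fun k => ?_⟩
  simp only [prefixMean, ContinuousMap.coe_mk, shiftMap_iterate_apply]

/-! ### The proposition. -/

theorem propositionP (a : ℝ → ℝ) (ha : IsHardyFieldFunction a) (d : ℕ)
    (hgrowth :
      ((fun t : ℝ => t ^ d) =o[atTop] a ∧ a =o[atTop] (fun t : ℝ => t ^ (d + 1))) ∨
      ∃ α : ℝ, Irrational α ∧ (fun t : ℝ => a t - t ^ d * α) =o[atTop] (fun t : ℝ => t ^ d))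
    (M : ℕ → ℕ) (hM : Tendsto M atTop atTop)
    (lam : Measure UnitAddCircle) [IsProbabilityMeasure lam]
    (hlam : IsWeakStarLimit
      (fun k => empiricalMeasure
        (fun n : ℕ => ((iteratedDeriv d a (n : ℝ) : ℝ) : UnitAddCircle)) (M k)) lam)
    (b : ℤ → Circle) (hb : ∀ n : ℕ, 0 < n → b (n : ℤ) = Circle.exp (2 * π * a (n : ℝ))) :
    AdmitsCorrelations b M ∧
      (∃ μ : Measure (ℤ → Circle), IsFurstenbergMeasure b M μ) ∧
      ∀ μ : Measure (ℤ → Circle), IsFurstenbergMeasure b M μ →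
        AreIsomorphicSystems μ (shiftMap Circle) (unipotentMeasure d lam) (unipotentMap d) := by
  obtain ⟨H, hH, haH⟩ := ha
  obtain ⟨h1, h2⟩ := hH.nonresonant_of_growth haH d hgrowth
  have h2' := h2 (d + 1) (Nat.lt_succ_self d)
  have hν := hH.tendsto_prefixMean_differencePoint haH d h1 h2 hM hlam
  have hmain := hH.tendsto_prefixMean_shift haH d h2' hM hν hb
  have hinv := hH.map_unipotentMap_eq haH d h2' hM hν
  have hprob : IsProbabilityMeasure ((unipotentMeasure d lam).map (orbitCoding d)) :=
    Measure.isProbabilityMeasure_map (continuous_orbitCoding d).measurable.aemeasurable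
  have hlim := isWeakStarLimit_empiricalMeasure_iff.2 hmain
  refine ⟨admitsCorrelations_of_tendsto fun f => ⟨_, hmain f⟩, ⟨_, hprob, hlim⟩, ?_⟩
  rintro μ ⟨hμ, hμlim⟩
  -- Weak-star limits are unique, so every Furstenberg measure is the image of λ × m under the
  -- coding.
  have : μ = (unipotentMeasure d lam).map (orbitCoding d) :=
    measure_eq_of_forall_integral_eq fun f => tendsto_nhds_unique (hμlim f) (hlim f)
  rw [this]
  exact areIsomorphicSystems_map_orbitCoding hinv
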